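/- For $k\ge 1$ let $$\Gamma_{8k}=\Big\{(x_1,\dots,x_{8k})\in\mathbb{Z}^{8k}\cup\big(\mathbb{Z}+\tfrac12\big)^{8k}:\ \sum_{i=1}^{8k}x_i\equiv 0 \pmod 2\Big\},\qquad \Theta_{\Gamma_{8k}}(\tau)=\sum_{x\in\Gamma_{8k}}e^{\pi i\tau\|x\|^2}\quad(\operatorname{Im}\tau>0).$$ Let $\rho=e^{\pi i/3}$, let $\mathcal{L}_\rho=\{\tfrac12+it:\ t\ge\tfrac{\sqrt3}{2}\}$, and let $$\mathcal{F}=\{z:\operatorname{Im}z>0,\ |z|>1,\ -\tfrac12<\operatorname{Re}z<0\}\cup\{z:\operatorname{Im}z>0,\ |z|\ge1,\ 0\le\operatorname{Re}z\le\tfrac12\}$$ be the fundamental domain of $\mathrm{SL}_2(\mathbb{Z})$. Let $Z_k$ be the set of zeros of $\Theta_{\Gamma_{8k}}$ in $\mathcal{F}\setminus\{\rho\}$. Let $\lambda=\theta_2^4/\theta_3^4$ be the modular lambda function, where $\theta_2(\tau)=\sum_{n\in\mathbb{Z}}e^{\pi i(n+1/2)^2\tau}$ and $\theta_3(\tau)=\sum_{n\in\mathbb{Z}}e^{\pi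 i n^2\tau}$, and put $$\varrho(y)=\frac{3}{\pi}\cdot\frac{\lambda'(\frac12+iy)}{\lambda(\frac12+iy)-1}.$$ For every $k\ge1$ the set $Z_k$ is contained in $\mathcal{L}_\rho$ and has exactly $\ell=\lfloor k/3\rfloor$ elements, and $\varrho$ is real and non-negative on $[\frac{\sqrt3}{2},\infty)$. As $k\to\infty$, the zeros become equidistributed on $\mathcal{L}_\rho$ with respect to the measure $\varrho(y)\,dy$: for all $\frac{\sqrt3}{2}\le a\le b$, $$\frac{\#\{\tau\in Z_k:\ a\le\operatorname{Im}\tau\le b\}}{\lfloor k/3\rfloor}\longrightarrow\int_a^b\varrho(y)\,dy,$$ and for every bounded continuous $f:\mathcal{L}_\rho\to\mathbb{R}$, $$\frac{1}{\lfloor k/3\rfloor}\sum_{\tau\in Z_k}f(\tau)\longrightarrow\int_{\sqrt3/2}^{\infty}f\big(\tfrac12+iy\big)\,\varrho(y)\,dy.$$ Moreover, $\varrho(y)\sim48e^{-\pi y}$ as $y\to\infty$. -/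

import Mathlib

noncomputable section

namespace LatticeTheta

/-- The lattice `Γ_{8k} ⊂ ℝ^{8k}`: vectors whose coordinates are all integers or all
half-integers (elements of `ℤ + 1/2`), with coordinate sum an even integer. -/
def Gamma8 (k : ℕ) : Set (EuclideanSpace ℝ (Fin (8 * k))) :=
  {x | ((∀ i, ∃ n : ℤ, x i = n) ∨ (∀ i, ∃ n : ℤ, x i = n + 1 / 2)) ∧
    ∃ m : ℤ, ∑ i, x i = 2 * m}

/-- The theta function `Θ_Λ(τ) = ∑_{x ∈ Λ} exp (π i τ ‖x‖²)` of a subset `Λ` of `ℝ^d`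
(used for lattices `Λ` and for `τ` in the upper half-plane, where the series converges
absolutely). -/
def latticeTheta {d : ℕ} (L : Set (EuclideanSpace ℝ (Fin d))) (τ : ℂ) : ℂ :=
  ∑' x : L, Complex.exp (Real.pi * Complex.I * τ * (‖(x : EuclideanSpace ℝ (Fin d))‖ : ℂ) ^ 2)

/-- The Jacobi theta function `θ₂(τ) = ∑_{n ∈ ℤ} exp (π i (n + 1/2)² τ)`. -/
def theta2 (τ : ℂ) : ℂ :=
  ∑' n : ℤ, Complex.exp (Real.pi * Complex.I * ((n : ℂ) + 1 / 2) ^ 2 * τ)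

/-- The modular lambda function `λ = θ₂⁴ / θ₃⁴`. Mathlib's `jacobiTheta` is
`θ₃(τ) = ∑_{n ∈ ℤ} exp (π i n² τ)`. -/
def modularLambda (τ : ℂ) : ℂ :=
  theta2 τ ^ 4 / jacobiTheta τ ^ 4

/-- The point `1/2 + i y`. -/
def linePoint (y : ℝ) : ℂ := 1 / 2 + y * Complex.I

/-- The point `ρ = exp (π i / 3) = 1/2 + (√3/2) i`. -/
def rhoPoint : ℂ := Complex.exp (Real.pi * Complex.I / 3)

/-- The half-line `L_ρ = {1/2 + i t : t ≥ √3/2}`. -/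
def lineRho : Set ℂ := linePoint '' Set.Ici (Real.sqrt 3 / 2)

/-- The strict fundamental domain of `SL₂(ℤ)` acting on the upper half-plane. -/
def fundDomain : Set ℂ :=
  {z | 0 < z.im ∧ 1 < ‖z‖ ∧ -(1 / 2) < z.re ∧ z.re < 0} ∪
    {z | 0 < z.im ∧ 1 ≤ ‖z‖ ∧ 0 ≤ z.re ∧ z.re ≤ 1 / 2}

/-- The zeros of `Θ_{Γ_{8k}}` in the fundamental domain, other than `ρ`. -/
def thetaZeros (k : ℕ) : Set ℂ :=
  {τ | τ ∈ fundDomain ∧ τ ≠ rhoPoint ∧ latticeTheta (Gamma8 k) τ = 0}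

/-- The function `ϱ(y) = (3/π) λ'(1/2 + i y) / (λ(1/2 + i y) - 1)`, with `λ'` the complex
derivative. It is a complex-valued expression; that it is a real density is part of the theorem. -/
def zeroDensity (y : ℝ) : ℂ :=
  3 / Real.pi * (deriv modularLambda (linePoint y) / (modularLambda (linePoint y) - 1))

end LatticeTheta

end

/-! ### The theta series of `Γ_{8k}` in terms of `θ₂`, `θ₃`, `θ₄`. -/

namespace LatticeTheta

open Complex Filter Topology Set

/-! Splitting `Γ_{8k}` into integral and half-integral vectors gives 2Θ = θ₂^{8k} + θ₃^{8k} +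
θ₄^{8k}. Jacobi's identity θ₃⁴ = θ₂⁴ + θ₄⁴ turns this into 2Θ/θ₃^{8k} = P(λ) with P(x) = 1 + x^{2k}
+ (1 - x)^{2k}. The zeros of Θ thus come from the roots of a polynomial of degree at most 2k, whose
root set is stable under conjugation, x ↦ 1 - x and x ↦ 1/x.

On `L_ρ` the nome is purely imaginary, which forces |1 - λ| = 1; write 1 - λ = e^{-2iφ}. The angle φ
decreases from π/6 at ρ to 0 at i∞, and up to a phase P becomes the real function 2cos(2kφ) ± (2 sin
φ)^{2k}. Its second term is at most 1 in absolute value there, so the sign alternates along the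
multiples of π/(2k), which yields ⌊k/3⌋ zeros. By symmetry each accounts for six roots of P, and
e^{±πi/3} are roots of multiplicity at least k mod 3. Since 6⌊k/3⌋ + 2(k mod 3) = 2k, these are all
the roots (`six_mul_card_add_le`, `exists_arcTrig_zeros`). At points of the fundamental domain with
|Re τ| < 1/2, `norm_theta2_lt` and `norm_theta4_lt` place λ in the lens |x| < 1, |1 - x| < 1, where
P has no root.

One zero in each interval of length π/(2k) makes the angles uniformly distributed on (0, π/6). Since
ϱ is 3/π times the logarithmic derivative of 1 - λ, one has φ' = -(π/6)ϱ (`hasDerivAt_lineAngle`),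
so ϱ dy is the uniform measure read in the coordinate y. The asymptotics of ϱ come from the leading
term of the q-expansion. -/

lemma hasSum_pi_prod {f : ℤ → ℂ} (hf : Summable fun n => ‖f n‖) (n : ℕ) :
    (Summable fun v : Fin n → ℤ => ‖∏ i, f (v i)‖) ∧
      HasSum (fun v : Fin n → ℤ => ∏ i, f (v i)) ((∑' m, f m) ^ n) := by
  induction n with
  | zero =>
    refine ⟨(hasSum_fintype _).summable, ?_⟩
    simp
  -- Absolute convergence is carried along the induction because the product formula for two series
  -- needs it.
  | succ n ih =>
    have key : ∀ p : ℤ × (Fin n → ℤ), ∏ i, f (Fin.consEquiv (fun _ : Fin (n + 1) => ℤ) p i)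
        = f p.1 * ∏ i, f (p.2 i) := by
      intro p
      simp [Fin.consEquiv, Fin.prod_univ_succ]
    constructor
    · rw [← (Fin.consEquiv (fun _ : Fin (n + 1) => ℤ)).summable_iff]
      refine (hf.mul_norm ih.1).congr fun p => ?_
      simp only [Function.comp]
      rw [key]
    · rw [← (Fin.consEquiv (fun _ : Fin (n + 1) => ℤ)).hasSum_iff, pow_succ', ← ih.2.tsum_eq,
        tsum_mul_tsum_of_summable_norm hf ih.1]
      have := (summable_mul_of_summable_norm hf ih.1).hasSum
      refine this.congr_fun ?_ 
      intro p
      simp only [Function.comp]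
      rw [key]

lemma neg_one_zpow_eq_ite (m : ℤ) : ((-1 : ℂ)) ^ m = if Even m then 1 else -1 := by
  split_ifs with h
  · exact h.neg_one_zpow
  · exact (Int.not_even_iff_odd.mp h).neg_one_zpow

lemma summable_norm_alternating {f : ℤ → ℂ} (hf : Summable fun n => ‖f n‖) :
    Summable fun n : ℤ => ‖(-1 : ℂ) ^ n * f n‖ := by
  refine hf.congr fun n => ?_
  simp

/-- The parity condition is detected by the average of the two characters 1 and (-1)^{Σ vᵢ}; both
factor over the coordinates. -/
lemma hasSum_even_pi_prod {f : ℤ → ℂ} (hf : Summable fun n => ‖f n‖) (n : ℕ) :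
    HasSum (fun v : {v : Fin n → ℤ // Even (∑ i, v i)} => ∏ i, f (v.1 i))
      (((∑' m, f m) ^ n + (∑' m : ℤ, (-1) ^ m * f m) ^ n) / 2) := by
  have h1 := (hasSum_pi_prod hf n).2
  have h2 := (hasSum_pi_prod (summable_norm_alternating hf) n).2
  have h3 := (h1.add h2).div_const 2
  refine (hasSum_subtype_iff_indicator (f := fun v : Fin n → ℤ => ∏ i, f (v i))
    (s := {v | Even (∑ i, v i)})).mpr ?_
  refine h3.congr_fun fun v => ?_
  have : ∏ i, ((-1 : ℂ) ^ (v i) * f (v i)) = (-1) ^ (∑ i, v i) * ∏ i, f (v i) := by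
    rw [Finset.prod_mul_distrib]
    congr 1
    induction (Finset.univ : Finset (Fin n)) using Finset.induction_on with
    | empty => simp
    | insert a s ha ih => rw [Finset.prod_insert ha, Finset.sum_insert ha, ih, zpow_add₀ (by simp)]
  rw [this, neg_one_zpow_eq_ite]
  by_cases h : Even (∑ i, v i) <;> simp [Set.indicator, h]

/-- The Jacobi theta function `θ₄(τ) = ∑ (-1)ⁿ exp (π i n² τ)`. -/
noncomputable def theta4 (τ : ℂ) : ℂ := ∑' n : ℤ, (-1) ^ n * exp (Real.pi * I * (n : ℂ) ^ 2 * τ)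

lemma exp_pi_mul_I_mul_int (n : ℤ) : exp (Real.pi * I * n) = (-1) ^ n := by
  rw [mul_comm, exp_int_mul, exp_pi_mul_I]

lemma jacobiTheta₂_half (τ : ℂ) : jacobiTheta₂ (1 / 2) τ = theta4 τ := by
  refine tsum_congr fun n => ?_
  rw [jacobiTheta₂_term, exp_add, ← exp_pi_mul_I_mul_int]
  congr 2
  ring

lemma neg_one_zpow_sq (n : ℤ) : (-1 : ℂ) ^ (n ^ 2) = (-1) ^ n := by
  rw [neg_one_zpow_eq_ite, neg_one_zpow_eq_ite]
  simp [Int.even_pow]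

lemma jacobiTheta_eq_tsum (τ : ℂ) :
    jacobiTheta τ = ∑' n : ℤ, exp (Real.pi * I * (n : ℂ) ^ 2 * τ) := rfl

lemma jacobiTheta_add_one (τ : ℂ) : jacobiTheta (τ + 1) = theta4 τ := by
  rw [jacobiTheta_eq_tsum]
  refine tsum_congr fun n => ?_
  rw [← neg_one_zpow_sq, ← exp_pi_mul_I_mul_int, ← exp_add]
  congr 1
  push_cast
  ring

lemma theta2_term_eq (τ : ℂ) (n : ℤ) : exp (Real.pi * I * ((n : ℂ) + 1 / 2) ^ 2 * τ) =
    exp (Real.pi * I * τ / 4) * jacobiTheta₂_term n (τ / 2) τ := by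
  rw [jacobiTheta₂_term, ← exp_add]
  congr 1
  ring

lemma theta2_eq_jacobiTheta₂ (τ : ℂ) :
    theta2 τ = exp (Real.pi * I * τ / 4) * jacobiTheta₂ (τ / 2) τ := by
  rw [theta2, jacobiTheta₂, ← tsum_mul_left]
  exact tsum_congr fun n => theta2_term_eq τ n

lemma summable_norm_theta3 {τ : ℂ} (hτ : 0 < τ.im) :
    Summable fun n : ℤ => ‖exp (Real.pi * I * (n : ℂ) ^ 2 * τ)‖ := by
  have := ((summable_jacobiTheta₂_term_iff 0 τ).mpr hτ).norm
  refine this.congr fun n => ?_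
  simp [jacobiTheta₂_term]

lemma summable_norm_theta2 {τ : ℂ} (hτ : 0 < τ.im) :
    Summable fun n : ℤ => ‖exp (Real.pi * I * ((n : ℂ) + 1 / 2) ^ 2 * τ)‖ := by
  have := (((summable_jacobiTheta₂_term_iff (τ / 2) τ).mpr hτ).norm).mul_left
    ‖exp (Real.pi * I * τ / 4)‖
  refine this.congr fun n => ?_
  rw [theta2_term_eq, norm_mul]

/-- The alternating half-integral theta series vanishes. -/
lemma tsum_alternating_theta2 (τ : ℂ) :
    ∑' n : ℤ, (-1) ^ n * exp (Real.pi * I * ((n : ℂ) + 1 / 2) ^ 2 * τ) = 0 := by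
  -- The reflection n ↦ -1 - n fixes (n + 1/2)² and reverses the parity of n, so the sum equals its
  -- own negative.
  have h := (Equiv.subLeft (-1 : ℤ)).tsum_eq
    (fun n : ℤ => (-1 : ℂ) ^ n * exp (Real.pi * I * ((n : ℂ) + 1 / 2) ^ 2 * τ))
  have h2 : ∀ n : ℤ, (-1 : ℂ) ^ (Equiv.subLeft (-1 : ℤ) n) *
      exp (Real.pi * I * (((Equiv.subLeft (-1 : ℤ) n : ℤ) : ℂ) + 1 / 2) ^ 2 * τ) =
      -((-1) ^ n * exp (Real.pi * I * ((n : ℂ) + 1 / 2) ^ 2 * τ)) := by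
    intro n
    have e1 : (-1 : ℂ) ^ (-1 - n) = - (-1) ^ n := by
      rw [zpow_sub₀ (by simp)]
      rcases Int.even_or_odd n with h | h <;> simp [h.neg_one_zpow]
    rw [Equiv.subLeft_apply, e1]
    push_cast
    rw [neg_mul]
    congr 4
    ring
  rw [tsum_congr h2, tsum_neg] at h
  exact self_eq_neg.mp h.symm

/-- A half-integral vector v + 1/2 has coordinate sum Σ vᵢ + 4k, so both cosets carry the same
condition that Σ vᵢ be even. The alternating half-integral series vanishes, which is why only three
of the four possible powers survive. -/
lemma latticeTheta_Gamma8 {k : ℕ} (hk : 1 ≤ k) {τ : ℂ} (hτ : 0 < τ.im) :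
    latticeTheta (Gamma8 k) τ =
      (theta2 τ ^ (8 * k) + jacobiTheta τ ^ (8 * k) + theta4 τ ^ (8 * k)) / 2 := by
  have H3 := hasSum_even_pi_prod (summable_norm_theta3 hτ) (8 * k)
  have H2 := hasSum_even_pi_prod (summable_norm_theta2 hτ) (8 * k)
  rw [tsum_alternating_theta2, zero_pow (by omega), add_zero] at H2
  set E := {v : Fin (8 * k) → ℤ // Even (∑ i, v i)}
  let e1 : E → Gamma8 k := fun v => ⟨WithLp.toLp 2 fun i => (v.1 i : ℝ), Or.inl fun i => ⟨v.1 i, rfl⟩, by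
    obtain ⟨m, hm⟩ := v.2
    refine ⟨m, ?_⟩
    have : ((∑ i, v.1 i : ℤ) : ℝ) = m + m := by rw [hm]; push_cast; ring
    push_cast at this
    simp only [this]
    ring⟩
  let e2 : E → Gamma8 k := fun v => ⟨WithLp.toLp 2 fun i => (v.1 i : ℝ) + 1 / 2, Or.inr fun i => ⟨v.1 i, rfl⟩, by
    obtain ⟨m, hm⟩ := v.2
    refine ⟨m + 2 * k, ?_⟩
    have : ((∑ i, v.1 i : ℤ) : ℝ) = m + m := by rw [hm]; push_cast; ring
    push_cast at this
    simp only [Finset.sum_add_distrib, this]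
    simp
    ring⟩
  have hn : 0 < 8 * k := by omega
  have hbij : Function.Bijective (Sum.elim e1 e2) := by
    have hne : ∀ m n : ℤ, (m : ℝ) ≠ n + 1 / 2 := by
      intro m n h
      have h2 : ((2 * m : ℤ) : ℝ) = ((2 * n + 1 : ℤ) : ℝ) := by push_cast; linarith
      have := Int.cast_injective h2
      omega
    constructor
    · rintro (v | v) (w | w) h
      · congr 1
        ext i
        have := congrArg (fun x : Gamma8 k => x.1 i) h
        simpa [e1] using this
      · exact absurd (congrArg (fun x : Gamma8 k => x.1 ⟨0, hn⟩) h) (hne _ _)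
      · exact absurd (congrArg (fun x : Gamma8 k => x.1 ⟨0, hn⟩) h).symm (hne _ _)
      · congr 1
        ext i
        have := congrArg (fun x : Gamma8 k => x.1 i) h
        simpa [e2] using this
    · rintro ⟨x, hx' | hx', m, hm⟩
      · choose v hv using id hx'
        refine ⟨Sum.inl ⟨v, ?_⟩, ?_⟩
        · refine ⟨m, ?_⟩
          simp only [hv] at hm
          have : ((∑ i, v i : ℤ) : ℝ) = ((m + m : ℤ) : ℝ) := by push_cast; linarith
          exact Int.cast_injective this
        · ext i
          simp [e1, hv]
      · choose v hv using id hx'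
        refine ⟨Sum.inr ⟨v, ?_⟩, ?_⟩
        · refine ⟨m - 2 * k, ?_⟩
          simp only [hv, Finset.sum_add_distrib] at hm
          simp at hm
          have : ((∑ i, v i : ℤ) : ℝ) = ((m - 2 * k + (m - 2 * k) : ℤ) : ℝ) := by
            push_cast; linarith
          exact Int.cast_injective this
        · ext i
          simp [e2, hv]
  have hnorm : ∀ x : EuclideanSpace ℝ (Fin (8 * k)),
      exp (Real.pi * I * τ * (‖x‖ : ℂ) ^ 2) = ∏ i, exp (Real.pi * I * ((x i : ℝ) : ℂ) ^ 2 * τ) := by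
    intro x
    rw [← exp_sum, ← ofReal_pow, EuclideanSpace.real_norm_sq_eq]
    congr 1
    push_cast
    rw [Finset.mul_sum]
    exact Finset.sum_congr rfl fun i _ => by ring
  have := (Equiv.ofBijective _ hbij).hasSum_iff
    (f := fun x : Gamma8 k => exp (Real.pi * I * τ * (‖(x : EuclideanSpace ℝ (Fin (8 * k)))‖ : ℂ) ^ 2))
    (a := theta2 τ ^ (8 * k) / 2 + (jacobiTheta τ ^ (8 * k) + theta4 τ ^ (8 * k)) / 2)
  rw [latticeTheta, (this.mp ?_).tsum_eq]
  · ring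
  rw [add_comm]
  refine HasSum.sum ?_ ?_
  · refine H3.congr_fun fun v => ?_
    simp only [Function.comp, Equiv.ofBijective_apply, Sum.elim_inl]
    rw [hnorm]
    simp [e1]
  · refine H2.congr_fun fun v => ?_
    simp only [Function.comp, Equiv.ofBijective_apply, Sum.elim_inr]
    rw [hnorm]
    simp [e2]

/-! ### Duplication formulas, Jacobi's identity and inversion. -/

/-- The pairs of integers of even and of odd sum, both parametrized by pairs of integers. -/
lemma bijective_parity_split : Function.Bijective
    (Sum.elim (fun p : ℤ × ℤ => ((p.1 + p.2, p.1 - p.2) : ℤ × ℤ))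
      (fun p : ℤ × ℤ => ((p.1 + p.2 + 1, p.1 - p.2) : ℤ × ℤ))) := by
  constructor
  · rintro (⟨a, b⟩ | ⟨a, b⟩) (⟨c, d⟩ | ⟨c, d⟩) h <;> simp at h ⊢ <;> omega
  · rintro ⟨m, n⟩
    rcases Int.even_or_odd (m + n) with ⟨u, h⟩ | ⟨u, h⟩
    · exact ⟨Sum.inl (u, m - u), by simp; omega⟩
    · exact ⟨Sum.inr (u, m - u - 1), by simp; omega⟩

/-- Rotating the lattice ℤ² by 45 degrees separates the variables: (u+v)² + (u-v)² = 2u² + 2v², and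
the odd coset gives 2(u+1/2)² + 2(v+1/2)². This is the common source of the three duplication
formulas. -/
lemma tsum_mul_tsum_parity {f g h1 h2 h3 h4 : ℤ → ℂ} (hf : Summable fun n => ‖f n‖)
    (hg : Summable fun n => ‖g n‖) (hh1 : Summable fun n => ‖h1 n‖)
    (hh2 : Summable fun n => ‖h2 n‖) (hh3 : Summable fun n => ‖h3 n‖)
    (hh4 : Summable fun n => ‖h4 n‖)
    (he : ∀ u v, f (u + v) * g (u - v) = h1 u * h2 v)
    (ho : ∀ u v, f (u + v + 1) * g (u - v) = h3 u * h4 v) :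
    (∑' n, f n) * (∑' n, g n) = (∑' n, h1 n) * (∑' n, h2 n) + (∑' n, h3 n) * (∑' n, h4 n) := by
  rw [tsum_mul_tsum_of_summable_norm hf hg, tsum_mul_tsum_of_summable_norm hh1 hh2,
    tsum_mul_tsum_of_summable_norm hh3 hh4]
  refine HasSum.tsum_eq ((Equiv.ofBijective _ bijective_parity_split).hasSum_iff.mp ?_)
  refine HasSum.sum ?_ ?_
  · refine (summable_mul_of_summable_norm hh1 hh2).hasSum.congr_fun fun p => ?_
    exact he p.1 p.2
  · refine (summable_mul_of_summable_norm hh3 hh4).hasSum.congr_fun fun p => ?_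
    exact ho p.1 p.2

lemma jacobiTheta_sq {τ : ℂ} (hτ : 0 < τ.im) :
    jacobiTheta τ ^ 2 = jacobiTheta (2 * τ) ^ 2 + theta2 (2 * τ) ^ 2 := by
  have h2 : 0 < (2 * τ).im := by simpa using hτ
  rw [sq (jacobiTheta τ), sq (jacobiTheta _), sq (theta2 _)]
  simp only [jacobiTheta_eq_tsum, theta2]
  refine tsum_mul_tsum_parity (summable_norm_theta3 hτ) (summable_norm_theta3 hτ)
    (summable_norm_theta3 h2) (summable_norm_theta3 h2) (summable_norm_theta2 h2)
    (summable_norm_theta2 h2) (fun u v => ?_) (fun u v => ?_) <;>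
  · simp only [← exp_add]
    congr 1
    push_cast
    ring

lemma theta4_sq {τ : ℂ} (hτ : 0 < τ.im) :
    theta4 τ ^ 2 = jacobiTheta (2 * τ) ^ 2 - theta2 (2 * τ) ^ 2 := by
  have h2 : 0 < (2 * τ).im := by simpa using hτ
  have h4 := summable_norm_alternating (summable_norm_theta3 hτ)
  rw [sub_eq_add_neg, sq (theta2 _), sq (theta4 _), sq (jacobiTheta _), neg_mul_eq_neg_mul]
  simp only [jacobiTheta_eq_tsum, theta2, theta4, ← tsum_neg]
  refine tsum_mul_tsum_parity h4 h4 (summable_norm_theta3 h2) (summable_norm_theta3 h2)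
    ((summable_norm_theta2 h2).congr fun n => (norm_neg _).symm)
    (summable_norm_theta2 h2) (fun u v => ?_) (fun u v => ?_)
  · rw [mul_mul_mul_comm, ← zpow_add₀ (by simp), ← exp_add, ← exp_add, Even.neg_one_zpow, one_mul]
    · congr 1
      push_cast
      ring
    · exact ⟨u, by ring⟩
  · rw [mul_mul_mul_comm, ← zpow_add₀ (by simp), ← exp_add, neg_mul, ← exp_add, Odd.neg_one_zpow,
      neg_mul, one_mul]
    · congr 2
      push_cast
      ring
    · exact ⟨u, by ring⟩

lemma theta2_sq {τ : ℂ} (hτ : 0 < τ.im) :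
    theta2 τ ^ 2 = 2 * theta2 (2 * τ) * jacobiTheta (2 * τ) := by
  have h2 : 0 < (2 * τ).im := by simpa using hτ
  have : theta2 τ * theta2 τ = theta2 (2 * τ) * jacobiTheta (2 * τ) +
      jacobiTheta (2 * τ) * theta2 (2 * τ) := by
    simp only [jacobiTheta_eq_tsum, theta2]
    -- On the odd coset (u+v+3/2)² + (u-v+1/2)² = 2(u+1)² + 2(v+1/2)², so one factor `θ₃` appears
    -- with its index shifted by one.
    have hshift : ∑' n : ℤ, exp (Real.pi * I * (n : ℂ) ^ 2 * (2 * τ)) =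
        ∑' n : ℤ, exp (Real.pi * I * ((n : ℂ) + 1) ^ 2 * (2 * τ)) := by
      rw [← (Equiv.addRight (1 : ℤ)).tsum_eq]
      simp
    have hs : Summable fun n : ℤ => ‖exp (Real.pi * I * ((n : ℂ) + 1) ^ 2 * (2 * τ))‖ := by
      have := (Equiv.addRight (1 : ℤ)).summable_iff.mpr (summable_norm_theta3 h2)
      refine this.congr fun n => ?_
      simp
    nth_rewrite 2 [hshift]
    refine tsum_mul_tsum_parity (summable_norm_theta2 hτ) (summable_norm_theta2 hτ)
      (summable_norm_theta2 h2) (summable_norm_theta3 h2) hs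
      (summable_norm_theta2 h2) (fun u v => ?_) (fun u v => ?_) <;>
    · simp only [← exp_add]
      congr 1
      push_cast
      ring
  rw [sq, this]
  ring

/-- Jacobi's identity `θ₃⁴ = θ₂⁴ + θ₄⁴`. -/
theorem jacobi_identity {τ : ℂ} (hτ : 0 < τ.im) :
    jacobiTheta τ ^ 4 = theta2 τ ^ 4 + theta4 τ ^ 4 := by
  -- With a = θ₃(2τ) and b = θ₂(2τ), duplication reduces the identity to (a² + b²)² = (2ab)² + (a² -
  -- b²)².
  have e : ∀ z : ℂ, z ^ 4 = (z ^ 2) ^ 2 := fun z => by ring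
  rw [e, e, e (theta4 τ), jacobiTheta_sq hτ, theta4_sq hτ, theta2_sq hτ]
  ring

/-- The quotients `θ₄/θ₃` and `θ₂/θ₃` are exchanged by `τ ↦ -1/τ`. -/
lemma theta4_mul_jacobiTheta_neg_inv (τ : ℂ) :
    theta4 τ * jacobiTheta (-1 / τ) = theta2 (-1 / τ) * jacobiTheta τ := by
  -- Both theta values at τ transform with the same automorphy factor, which is common to the two
  -- sides.
  rw [← jacobiTheta₂_half, theta2_eq_jacobiTheta₂, jacobiTheta_eq_jacobiTheta₂ τ,
    jacobiTheta₂_functional_equation (1 / 2) τ, jacobiTheta₂_functional_equation 0 τ,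
    jacobiTheta_eq_jacobiTheta₂, ← jacobiTheta₂_neg_left (1 / 2 / τ)]
  have e1 : -(1 / 2 / τ) = -1 / τ / 2 := by ring
  have e2 : (-Real.pi * I * (1 / 2) ^ 2 / τ : ℂ) = Real.pi * I * (-1 / τ) / 4 := by ring
  rw [e1, e2]
  simp
  ring

/-! ### Estimates for theta constants in the nome. -/

/-- The theta function `θ₃` as a function of the nome `q = exp (π i τ)`. -/
noncomputable def psi (q : ℂ) : ℂ := 1 + 2 * ∑' n : ℕ, q ^ ((n + 1) ^ 2)

/-- The nome `q = exp (π i τ)`. -/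
noncomputable def nome (τ : ℂ) : ℂ := exp (Real.pi * I * τ)

lemma norm_nome (τ : ℂ) : ‖nome τ‖ = Real.exp (-Real.pi * τ.im) := by
  rw [nome, norm_exp]
  simp

lemma jacobiTheta_eq_psi {τ : ℂ} (hτ : 0 < τ.im) : jacobiTheta τ = psi (nome τ) := by
  rw [jacobiTheta_eq_tsum_nat hτ, psi]
  congr 2
  refine tsum_congr fun n => ?_
  rw [nome, ← exp_nat_mul]
  congr 1
  push_cast
  ring

lemma theta4_eq_psi {τ : ℂ} (hτ : 0 < τ.im) : theta4 τ = psi (-nome τ) := by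
  rw [← jacobiTheta_add_one, jacobiTheta_eq_psi (by simpa using hτ)]
  congr 1
  rw [nome, nome, mul_add, exp_add, mul_one, exp_pi_mul_I]
  ring

lemma norm_pow_sq_le {q : ℂ} {r : ℝ} (hq : ‖q‖ ≤ r) (hr : r < 1) (n : ℕ) :
    ‖q ^ ((n + 1 + 1) ^ 2)‖ ≤ r ^ 4 * r ^ n := by
  rw [norm_pow, ← pow_add]
  refine (pow_le_pow_left₀ (norm_nonneg _) hq _).trans
    (pow_le_pow_of_le_one ((norm_nonneg _).trans hq) hr.le ?_)
  nlinarith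

lemma summable_pow_sq {q : ℂ} (hq : ‖q‖ < 1) : Summable fun n : ℕ => q ^ ((n + 1) ^ 2) := by
  refine (summable_nat_add_iff 1).mp (Summable.of_norm_bounded
    ((summable_geometric_of_lt_one (norm_nonneg q) hq).mul_left (‖q‖ ^ 4)) fun n => ?_)
  exact norm_pow_sq_le le_rfl hq n

lemma norm_psi_sub_le_pow {q : ℂ} (hq : ‖q‖ ≤ 1 / 4) :
    ‖psi q - 1 - 2 * q‖ ≤ 8 / 3 * ‖q‖ ^ 4 := by
  have hq1 : ‖q‖ < 1 := by linarith
  have e : psi q - 1 - 2 * q = 2 * ∑' n : ℕ, q ^ ((n + 1 + 1) ^ 2) := by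
    rw [psi, (summable_pow_sq hq1).tsum_eq_zero_add]
    ring
  have hs := (hasSum_geometric_of_lt_one (norm_nonneg q) hq1).mul_left (‖q‖ ^ 4)
  have := tsum_of_norm_bounded hs (norm_pow_sq_le le_rfl hq1)
  have h2 : (1 - ‖q‖)⁻¹ ≤ 4 / 3 := by
    rw [inv_le_comm₀ (by linarith) (by norm_num)]
    linarith
  rw [e, norm_mul, Complex.norm_two]
  nlinarith [pow_nonneg (norm_nonneg q) 4]

lemma norm_psi_sub_le {q : ℂ} (hq : ‖q‖ ≤ 1 / 4) : ‖psi q - 1 - 2 * q‖ ≤ 1 / 96 := by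
  refine (norm_psi_sub_le_pow hq).trans ?_
  have : ‖q‖ ^ 4 ≤ (1 / 4) ^ 4 := pow_le_pow_left₀ (norm_nonneg _) hq 4
  linarith

lemma differentiableOn_psi : DifferentiableOn ℂ psi (Metric.ball 0 (1 / 2)) := by
  refine (differentiableOn_const _).add ((differentiableOn_const _).mul ?_)
  refine differentiableOn_tsum_of_summable_norm (u := fun n : ℕ => (1 / 2 : ℝ) ^ n)
    (summable_geometric_of_lt_one (by norm_num) (by norm_num))
    (fun n => (differentiable_id.pow _).differentiableOn) Metric.isOpen_ball fun n q hq => ?_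
  have hq : ‖q‖ ≤ 1 / 2 := by simpa using (mem_ball_zero_iff.mp hq).le
  rw [norm_pow]
  refine (pow_le_pow_left₀ (norm_nonneg _) hq _).trans
    (pow_le_pow_of_le_one (by norm_num) (by norm_num) ?_)
  nlinarith

lemma psi_conj (q : ℂ) : psi (starRingEnd ℂ q) = starRingEnd ℂ (psi q) := by
  simp [psi, Complex.conj_tsum, map_ofNat]

/-- The quotient of the odd part of `psi` by its even part. -/
noncomputable def oddRatio (q : ℂ) : ℂ := (psi q - psi (-q)) / (psi q + psi (-q))

lemma oddRatio_neg (q : ℂ) : oddRatio (-q) = -oddRatio q := by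
  rw [oddRatio, oddRatio, neg_neg, add_comm (psi (-q)), ← neg_div, neg_sub]

lemma oddRatio_conj (q : ℂ) : oddRatio (starRingEnd ℂ q) = starRingEnd ℂ (oddRatio q) := by
  rw [oddRatio, oddRatio, ← map_neg, psi_conj, psi_conj]
  simp

lemma oddRatio_zero : oddRatio 0 = 0 := by simp [oddRatio]

lemma norm_psi_add_sub_le {q : ℂ} (hq : ‖q‖ ≤ 1 / 4) : ‖psi q + psi (-q) - 2‖ ≤ 1 / 48 := by
  have h1 := norm_psi_sub_le hq
  have h2 := norm_psi_sub_le (q := -q) (by simpa using hq)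
  calc ‖psi q + psi (-q) - 2‖ = ‖(psi q - 1 - 2 * q) + (psi (-q) - 1 - 2 * -q)‖ := by
        congr 1; ring
    _ ≤ _ := (norm_add_le _ _).trans (by linarith)

lemma le_norm_psi_add {q : ℂ} (hq : ‖q‖ ≤ 1 / 4) : 95 / 48 ≤ ‖psi q + psi (-q)‖ := by
  have h := norm_psi_add_sub_le hq
  have := norm_sub_norm_le (2 : ℂ) (2 - (psi q + psi (-q)))
  rw [sub_sub_cancel, norm_sub_rev 2, Complex.norm_two] at this
  linarith

lemma psi_add_ne_zero {q : ℂ} (hq : ‖q‖ ≤ 1 / 4) : psi q + psi (-q) ≠ 0 := by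
  rw [← norm_pos_iff]
  linarith [le_norm_psi_add hq]

lemma psi_ne_zero {q : ℂ} (hq : ‖q‖ ≤ 1 / 4) : psi q ≠ 0 := by
  intro h
  have h1 := norm_psi_sub_le hq
  have e : (1 : ℂ) = -(psi q - 1 - 2 * q) - 2 * q := by rw [h]; ring
  have h2 := norm_sub_le (-(psi q - 1 - 2 * q)) (2 * q)
  rw [← e, norm_neg, norm_mul, Complex.norm_two, norm_one] at h2
  linarith

/-- To first order the odd part of `psi` is 2q and the even part is 1. The three errors in the
numerator total at most 1/32, and the denominator is at least 95/48. -/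
lemma norm_oddRatio_sub_le {q : ℂ} (hq : ‖q‖ ≤ 1 / 4) : ‖oddRatio q - 2 * q‖ ≤ 1 / 60 := by
  have h0 := psi_add_ne_zero hq
  have h1 := norm_psi_sub_le hq
  have h2 := norm_psi_sub_le (q := -q) (by simpa using hq)
  have h3 := norm_psi_add_sub_le hq
  have h4 := le_norm_psi_add hq
  have e : oddRatio q - 2 * q = ((psi q - 1 - 2 * q) - (psi (-q) - 1 - 2 * -q) -
      2 * q * (psi q + psi (-q) - 2)) / (psi q + psi (-q)) := by
    rw [oddRatio]
    field_simp
    ring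
  rw [e, norm_div, div_le_iff₀ (by linarith)]
  have h5 : ‖2 * q * (psi q + psi (-q) - 2)‖ ≤ 1 / 2 * (1 / 48) := by
    rw [norm_mul, norm_mul, Complex.norm_two]
    exact mul_le_mul (by linarith) h3 (norm_nonneg _) (by norm_num)
  have h6 := norm_sub_le ((psi q - 1 - 2 * q) - (psi (-q) - 1 - 2 * -q))
    (2 * q * (psi q + psi (-q) - 2))
  have h7 := norm_sub_le (psi q - 1 - 2 * q) (psi (-q) - 1 - 2 * -q)
  linarith

lemma differentiableOn_oddRatio : DifferentiableOn ℂ oddRatio (Metric.ball 0 (1 / 4)) := by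
  have h1 : DifferentiableOn ℂ psi (Metric.ball 0 (1 / 4)) :=
    differentiableOn_psi.mono (Metric.ball_subset_ball (by norm_num))
  have h2 : DifferentiableOn ℂ (fun q => psi (-q)) (Metric.ball 0 (1 / 4)) :=
    h1.comp differentiable_neg.differentiableOn fun q hq => by simpa using hq
  exact (h1.sub h2).div (h1.add h2) fun q hq =>
    psi_add_ne_zero (by simpa using (mem_ball_zero_iff.mp hq).le)

lemma differentiableAt_oddRatio {q : ℂ} (hq : ‖q‖ < 1 / 4) : DifferentiableAt ℂ oddRatio q :=
  differentiableOn_oddRatio.differentiableAt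
    (Metric.isOpen_ball.mem_nhds (mem_ball_zero_iff.mpr hq))

lemma continuousAt_deriv_oddRatio {q : ℂ} (hq : ‖q‖ < 1 / 4) :
    ContinuousAt (deriv oddRatio) q :=
  ((differentiableOn_oddRatio.deriv Metric.isOpen_ball).differentiableAt
    (Metric.isOpen_ball.mem_nhds (mem_ball_zero_iff.mpr hq))).continuousAt

/-- Cauchy's estimate on a circle of radius 7/50: the circle stays in the ball of radius 1/4 because
1/10 + 7/50 < 1/4, and (1/60)/(7/50) < 1/8. -/
lemma norm_deriv_oddRatio_sub_le {q : ℂ} (hq : ‖q‖ ≤ 1 / 10) : ‖deriv oddRatio q - 2‖ ≤ 1 / 8 := by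
  have hd : DifferentiableAt ℂ oddRatio q := differentiableAt_oddRatio (by linarith)
  have hsub : Metric.closedBall q (7 / 50) ⊆ Metric.ball 0 (1 / 4) := by
    intro z hz
    rw [mem_closedBall_iff_norm] at hz
    rw [mem_ball_zero_iff]
    have := norm_add_le (z - q) q
    rw [sub_add_cancel] at this
    linarith
  have hd2 : DifferentiableOn ℂ (fun z => oddRatio z - 2 * z) (Metric.ball 0 (1 / 4)) :=
    differentiableOn_oddRatio.sub (by fun_prop)
  have := norm_deriv_le_of_forall_mem_sphere_norm_le (f := fun z => oddRatio z - 2 * z) (c := q)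
    (R := 7 / 50) (C := 1 / 60) (by norm_num)
    ((hd2.mono hsub).diffContOnCl_ball subset_rfl)
    fun z hz => norm_oddRatio_sub_le
      (by simpa using (mem_ball_zero_iff.mp (hsub (Metric.sphere_subset_closedBall hz))).le)
  have e : deriv (fun z => oddRatio z - 2 * z) q = deriv oddRatio q - 2 := by
    have h2 : HasDerivAt (fun z : ℂ => 2 * z) 2 q := by simpa using (hasDerivAt_id q).const_mul 2
    exact (hd.hasDerivAt.sub h2).deriv
  rw [e] at this
  exact this.trans (by norm_num)

lemma norm_oddRatio_sub_sub_le {p q : ℂ} (hp : ‖p‖ ≤ 1 / 10) (hq : ‖q‖ ≤ 1 / 10) :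
    ‖oddRatio q - oddRatio p - 2 * (q - p)‖ ≤ 1 / 8 * ‖q - p‖ := by
  have h := (convex_closedBall (0 : ℂ) (1 / 10)).norm_image_sub_le_of_norm_hasDerivWithin_le
    (f := fun z => oddRatio z - 2 * z) (f' := fun z => deriv oddRatio z - 2) (C := 1 / 8)
    (fun z hz => ?_) (fun z hz => norm_deriv_oddRatio_sub_le (mem_closedBall_zero_iff.mp hz))
    (mem_closedBall_zero_iff.mpr hp) (mem_closedBall_zero_iff.mpr hq)
  · refine (le_of_eq ?_).trans h
    congr 1
    ring
  · have hz := mem_closedBall_zero_iff.mp hz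
    have h2 : HasDerivAt (fun z : ℂ => 2 * z) 2 z := by simpa using (hasDerivAt_id z).const_mul 2
    exact ((differentiableAt_oddRatio (by linarith)).hasDerivAt.sub h2).hasDerivWithinAt

lemma norm_oddRatio_le {q : ℂ} (hq : ‖q‖ ≤ 1 / 10) : ‖oddRatio q‖ ≤ 17 / 8 * ‖q‖ := by
  have h := norm_oddRatio_sub_sub_le (p := 0) (by simp) hq
  rw [oddRatio_zero, sub_zero, sub_zero] at h
  have h2 := norm_add_le (oddRatio q - 2 * q) (2 * q)
  rw [sub_add_cancel, norm_mul, Complex.norm_two] at h2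
  linarith

/-- On the imaginary axis conjugation is negation, and the function is both odd and real. -/
lemma oddRatio_re_imaginary (s : ℝ) : (oddRatio (s * I)).re = 0 := by
  have h := oddRatio_conj (s * I)
  have e : starRingEnd ℂ ((s : ℂ) * I) = -(s * I) := by simp
  rw [e, oddRatio_neg] at h
  have := congrArg Complex.re h
  simp only [neg_re, conj_re] at this
  linarith

/-- Compare q with its projection i·Im q, where the real part vanishes: the increment is 2 Re q with
error at most Re q / 8. -/
lemma oddRatio_re_pos {q : ℂ} (hq : ‖q‖ ≤ 1 / 10) (hre : 0 < q.re) : 0 < (oddRatio q).re := by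
  have hp : ‖(q.im : ℂ) * I‖ ≤ 1 / 10 := by
    rw [norm_mul, norm_I, mul_one, norm_real]
    exact (abs_im_le_norm q).trans hq
  have h := norm_oddRatio_sub_sub_le hp hq
  have e : q - q.im * I = (q.re : ℂ) := by
    apply Complex.ext <;> simp
  rw [e, norm_real, Real.norm_of_nonneg hre.le] at h
  have h2 := (abs_re_le_norm _).trans h
  rw [abs_le] at h2
  have h3 := h2.1
  simp only [sub_re, oddRatio_re_imaginary, mul_re, re_ofNat, im_ofNat, ofReal_re, ofReal_im] at h3
  linarith

lemma psi_eq_mul_one_add {q : ℂ} (hq : ‖q‖ ≤ 1 / 4) :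
    psi q = (psi q + psi (-q)) / 2 * (1 + oddRatio q) := by
  have := psi_add_ne_zero hq
  rw [oddRatio]
  field_simp
  ring

lemma psi_neg_eq_mul_one_sub {q : ℂ} (hq : ‖q‖ ≤ 1 / 4) :
    psi (-q) = (psi q + psi (-q)) / 2 * (1 - oddRatio q) := by
  have := psi_add_ne_zero hq
  rw [oddRatio]
  field_simp
  ring

lemma one_add_oddRatio_ne_zero {q : ℂ} (hq : ‖q‖ ≤ 1 / 4) : 1 + oddRatio q ≠ 0 := by
  intro h
  have := psi_eq_mul_one_add hq
  rw [h, mul_zero] at this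
  exact psi_ne_zero hq this

lemma one_sub_oddRatio_ne_zero {q : ℂ} (hq : ‖q‖ ≤ 1 / 4) : 1 - oddRatio q ≠ 0 := by
  have := one_add_oddRatio_ne_zero (q := -q) (by simpa using hq)
  rwa [oddRatio_neg, ← sub_eq_add_neg] at this

/-! ### Comparison of `θ₂`, `θ₄` with `θ₃` on the fundamental domain. -/

lemma exp_neg_pi_mul_le {y c : ℝ} (h : y ≤ c) : Real.exp (-Real.pi * c) ≤ Real.exp (-Real.pi * y) := by
  rw [Real.exp_le_exp]
  nlinarith [Real.pi_pos]

lemma norm_nome_lt_quarter {τ : ℂ} (hτ : 1 / 2 < τ.im) : ‖nome τ‖ < 1 / 4 := by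
  rw [norm_nome]
  refine (exp_neg_pi_mul_le hτ.le).trans_lt ?_
  have h1 : (4 : ℝ) < Real.exp (Real.pi * (1 / 2)) := by
    -- Splitting off integral powers of e leaves a small exponent, for which 1 + x ≤ exp x is sharp
    -- enough.
    have e : Real.exp (Real.pi * (1 / 2)) = Real.exp 1 * Real.exp (Real.pi * (1 / 2) - 1) := by
      rw [← Real.exp_add]; congr 1; ring
    have := Real.add_one_le_exp (Real.pi * (1 / 2) - 1)
    have h2 := Real.exp_one_gt_d9
    have h3 := Real.pi_gt_d2
    rw [e]
    nlinarith
  rw [neg_mul, Real.exp_neg, inv_lt_comm₀ (Real.exp_pos _) (by norm_num)]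
  linarith

lemma norm_nome_le_tenth {τ : ℂ} (hτ : 3 / 4 ≤ τ.im) : ‖nome τ‖ ≤ 1 / 10 := by
  rw [norm_nome]
  refine (exp_neg_pi_mul_le hτ).trans ?_
  have h1 : (10 : ℝ) ≤ Real.exp (Real.pi * (3 / 4)) := by
    have e : Real.exp (Real.pi * (3 / 4)) =
        Real.exp 1 * Real.exp 1 * Real.exp (Real.pi * (3 / 4) - 2) := by
      rw [← Real.exp_add, ← Real.exp_add]; congr 1; ring
    have h4 := Real.add_one_le_exp (Real.pi * (3 / 4) - 2)
    have h2 := Real.exp_one_gt_d9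
    have h3 := Real.pi_gt_d4
    have h5 : (2.718 : ℝ) * 2.718 ≤ Real.exp 1 * Real.exp 1 := by nlinarith
    rw [e]
    nlinarith
  rw [neg_mul, Real.exp_neg, inv_le_comm₀ (Real.exp_pos _) (by norm_num)]
  linarith

lemma norm_nome_le_of_high {τ : ℂ} (hτ : 11 / 10 ≤ τ.im) : ‖nome τ‖ ≤ 1 / 28 := by
  rw [norm_nome]
  refine (exp_neg_pi_mul_le hτ).trans ?_
  have h1 : (28 : ℝ) ≤ Real.exp (Real.pi * (11 / 10)) := by
    have e : Real.exp (Real.pi * (11 / 10)) =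
        Real.exp 1 * Real.exp 1 * Real.exp 1 * Real.exp (Real.pi * (11 / 10) - 3) := by
      rw [← Real.exp_add, ← Real.exp_add, ← Real.exp_add]; congr 1; ring
    have h4 := Real.add_one_le_exp (Real.pi * (11 / 10) - 3)
    have h2 := Real.exp_one_gt_d9
    have h3 := Real.pi_gt_d4
    have h5 : (2.718 : ℝ) * 2.718 ≤ Real.exp 1 * Real.exp 1 := by nlinarith
    have h6 : (2.718 : ℝ) * 2.718 * 2.718 ≤ Real.exp 1 * Real.exp 1 * Real.exp 1 := by nlinarith
    rw [e]
    nlinarith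
  rw [neg_mul, Real.exp_neg, inv_le_comm₀ (Real.exp_pos _) (by norm_num)]
  linarith

lemma jacobiTheta_ne_zero {τ : ℂ} (hτ : 1 / 2 < τ.im) : jacobiTheta τ ≠ 0 := by
  rw [jacobiTheta_eq_psi (by linarith)]
  exact psi_ne_zero (norm_nome_lt_quarter hτ).le

lemma norm_one_sub_lt_norm_one_add {z : ℂ} (hz : 0 < z.re) : ‖1 - z‖ < ‖1 + z‖ := by
  rw [← sq_lt_sq₀ (norm_nonneg _) (norm_nonneg _), ← normSq_eq_norm_sq, ← normSq_eq_norm_sq,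
    normSq_apply, normSq_apply]
  simp
  nlinarith

lemma nome_re_pos {τ : ℂ} (h : |τ.re| < 1 / 2) : 0 < (nome τ).re := by
  rw [nome, exp_re]
  refine mul_pos (Real.exp_pos _) (Real.cos_pos_of_mem_Ioo ?_)
  have := abs_lt.mp h
  simp
  constructor <;> nlinarith [Real.pi_pos]

/-- The even part of `psi`. -/
noncomputable def psiEven (q : ℂ) : ℂ := (psi q + psi (-q)) / 2

lemma norm_psiEven_pos {q : ℂ} (hq : ‖q‖ ≤ 1 / 4) : 0 < ‖psiEven q‖ := by
  rw [psiEven, norm_div, Complex.norm_two]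
  have := le_norm_psi_add hq
  linarith

lemma jacobiTheta_eq_psiEven_mul {τ : ℂ} (hτ : 1 / 2 < τ.im) :
    jacobiTheta τ = psiEven (nome τ) * (1 + oddRatio (nome τ)) := by
  rw [jacobiTheta_eq_psi (by linarith), psiEven]
  exact psi_eq_mul_one_add (norm_nome_lt_quarter hτ).le

lemma theta4_eq_psiEven_mul {τ : ℂ} (hτ : 1 / 2 < τ.im) :
    theta4 τ = psiEven (nome τ) * (1 - oddRatio (nome τ)) := by
  rw [theta4_eq_psi (by linarith), psiEven]
  exact psi_neg_eq_mul_one_sub (norm_nome_lt_quarter hτ).le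

/-- θ₄/θ₃ = (1 - f)/(1 + f) with f the odd ratio, and this Cayley transform has modulus below 1 when
Re f > 0. -/
lemma norm_theta4_lt {τ : ℂ} (hre : |τ.re| < 1 / 2) (him : 3 / 4 ≤ τ.im) :
    ‖theta4 τ‖ < ‖jacobiTheta τ‖ := by
  have hq := norm_nome_le_tenth him
  rw [theta4_eq_psiEven_mul (by linarith), jacobiTheta_eq_psiEven_mul (by linarith), norm_mul,
    norm_mul]
  exact mul_lt_mul_of_pos_left (norm_one_sub_lt_norm_one_add
    (oddRatio_re_pos hq (nome_re_pos hre))) (norm_psiEven_pos (by linarith))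

lemma norm_theta2_lt_of_high {τ : ℂ} (him : 11 / 10 ≤ τ.im) :
    ‖theta2 τ‖ < ‖jacobiTheta τ‖ := by
  have hq := norm_nome_le_of_high him
  have hf := norm_oddRatio_le (q := nome τ) (by linarith)
  have hE := norm_psiEven_pos (q := nome τ) (by linarith)
  have h3 := jacobiTheta_eq_psiEven_mul (τ := τ) (by linarith)
  have h4 := theta4_eq_psiEven_mul (τ := τ) (by linarith)
  have hJ := jacobi_identity (τ := τ) (by linarith)
  generalize oddRatio (nome τ) = f at *
  generalize psiEven (nome τ) = E at *
  have hf2 : ‖f‖ ≤ 8 / 100 := by linarith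
  refine lt_of_pow_lt_pow_left₀ 4 (norm_nonneg _) ?_
  -- By Jacobi's identity θ₂⁴ = θ₃⁴ - θ₄⁴ = E⁴((1+f)⁴ - (1-f)⁴), so smallness of f suffices.
  have e : theta2 τ ^ 4 = E ^ 4 * (8 * f * (1 + f ^ 2)) := by
    rw [← sub_eq_iff_eq_add] at hJ
    rw [← hJ, h3, h4]
    ring
  rw [← norm_pow, ← norm_pow, e, h3, mul_pow, norm_mul, norm_mul (E ^ 4), norm_mul (8 * f),
    norm_pow E, norm_pow (1 + f)]
  refine mul_lt_mul_of_pos_left ?_ (by positivity)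
  · have h1 : 92 / 100 ≤ ‖1 + f‖ := by
      have := norm_sub_le (1 + f) f
      rw [add_sub_cancel_right, norm_one] at this
      linarith
    have h2 : ‖1 + f ^ 2‖ ≤ 1 + (8 / 100) ^ 2 := by
      refine (norm_add_le _ _).trans ?_
      rw [norm_one, norm_pow]
      gcongr
    have h3 : (92 / 100 : ℝ) ^ 4 ≤ ‖1 + f‖ ^ 4 := by gcongr
    rw [norm_mul]
    have h4 : ‖(8 : ℂ)‖ * ‖f‖ * ‖1 + f ^ 2‖ ≤ 8 * (8 / 100) * (1 + (8 / 100) ^ 2) := by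
      have : ‖(8 : ℂ)‖ = 8 := by simp
      rw [this]
      gcongr
    refine lt_of_le_of_lt h4 (lt_of_lt_of_le (by norm_num) h3)

lemma norm_theta2_lt {τ : ℂ} (hre : |τ.re| < 1 / 2) (him : 0 < τ.im) (hn : 1 ≤ ‖τ‖) :
    ‖theta2 τ‖ < ‖jacobiTheta τ‖ := by
  rcases le_total (11 / 10) τ.im with h | h
  · exact norm_theta2_lt_of_high h
  have hre' := abs_lt.mp hre
  have hN : normSq τ = τ.re ^ 2 + τ.im ^ 2 := by rw [normSq_apply]; ring
  have hN1 : 1 ≤ normSq τ := by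
    rw [normSq_eq_norm_sq]
    nlinarith
  have hx : τ.re ^ 2 < 1 / 4 := by nlinarith
  have him2 : 86 / 100 < τ.im := by
    by_contra! h'
    nlinarith
  have h0 : τ ≠ 0 := by
    rintro rfl
    simp at him
  -- Inversion exchanges θ₂/θ₃ at τ with θ₄/θ₃ at σ. The cutoff 11/10 on Im τ is low enough for Im σ
  -- ≥ 3/4, as `norm_theta4_lt` requires.
  set σ := -1 / τ
  have hσre : σ.re = -τ.re / normSq τ := by simp [σ, neg_div, inv_re]
  have hσim : σ.im = τ.im / normSq τ := by simp [σ, neg_div, inv_im]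
  have h1 : |σ.re| < 1 / 2 := by
    rw [hσre, abs_div, abs_neg, abs_of_pos (by linarith : 0 < normSq τ), div_lt_iff₀ (by linarith)]
    linarith
  have h2 : 3 / 4 ≤ σ.im := by
    rw [hσim, le_div_iff₀ (by linarith), hN]
    nlinarith
  have h3 := norm_theta4_lt h1 h2
  have h4 := theta4_mul_jacobiTheta_neg_inv σ
  have e : -1 / σ = τ := by
    simp only [σ]
    field_simp
  rw [e] at h4
  have h5 := congrArg norm h4
  rw [norm_mul, norm_mul] at h5
  have h6 : 0 < ‖jacobiTheta σ‖ := (norm_nonneg _).trans_lt h3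
  have h7 : 0 < ‖jacobiTheta τ‖ := norm_pos_iff.mpr (jacobiTheta_ne_zero (by linarith))
  have h8 := mul_lt_mul_of_pos_right h3 h7
  rw [h5, mul_comm ‖jacobiTheta σ‖] at h8
  exact lt_of_mul_lt_mul_right h8 h6.le

end LatticeTheta

/-! ### The polynomial in λ, its symmetries and its restriction to the unit circle. -/

namespace LatticeTheta

open Complex Filter Topology Set Polynomial

/-- The polynomial `1 + X²ᵏ + (1 - X)²ᵏ`, whose value at `λ` is `2 Θ / θ₃⁸ᵏ`. -/
noncomputable def lambdaPoly (k : ℕ) : ℂ[X] := 1 + X ^ (2 * k) + (1 - X) ^ (2 * k)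

lemma eval_lambdaPoly (k : ℕ) (x : ℂ) :
    (lambdaPoly k).eval x = 1 + x ^ (2 * k) + (1 - x) ^ (2 * k) := by
  simp [lambdaPoly]

lemma natDegree_lambdaPoly_le (k : ℕ) : (lambdaPoly k).natDegree ≤ 2 * k := by
  unfold lambdaPoly
  compute_degree

lemma lambdaPoly_ne_zero {k : ℕ} (hk : 1 ≤ k) : lambdaPoly k ≠ 0 := by
  intro h
  have := eval_lambdaPoly k 0
  rw [h, eval_zero, zero_pow (by omega)] at this
  norm_num at this

lemma isRoot_lambdaPoly_one_sub {k : ℕ} {x : ℂ} (h : (lambdaPoly k).IsRoot x) :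
    (lambdaPoly k).IsRoot (1 - x) := by
  rw [IsRoot, eval_lambdaPoly] at h ⊢
  rw [sub_sub_cancel, ← h]
  ring

lemma isRoot_lambdaPoly_inv {k : ℕ} {x : ℂ} (hx : x ≠ 0) (h : (lambdaPoly k).IsRoot x) :
    (lambdaPoly k).IsRoot x⁻¹ := by
  rw [IsRoot, eval_lambdaPoly] at h ⊢
  have e : (1 - x⁻¹) ^ (2 * k) = (1 - x) ^ (2 * k) / x ^ (2 * k) := by
    rw [← div_pow, ← Even.neg_pow (even_two_mul k)]
    congr 1
    field_simp
    ring
  have hx' : x ^ (2 * k) ≠ 0 := pow_ne_zero _ hx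
  rw [e, inv_pow]
  generalize x ^ (2 * k) = a at *
  generalize (1 - x) ^ (2 * k) = b at *
  field_simp
  linear_combination h

lemma isRoot_lambdaPoly_conj {k : ℕ} {x : ℂ} (h : (lambdaPoly k).IsRoot x) :
    (lambdaPoly k).IsRoot (starRingEnd ℂ x) := by
  rw [IsRoot, eval_lambdaPoly] at h ⊢
  simpa using congrArg (starRingEnd ℂ) h

/-- The point `exp (2 i φ)` of the unit circle. -/
noncomputable def arcPoint (φ : ℝ) : ℂ := exp ((2 * φ : ℝ) * I)

lemma norm_arcPoint (φ : ℝ) : ‖arcPoint φ‖ = 1 := norm_exp_ofReal_mul_I _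

lemma arcPoint_re (φ : ℝ) : (arcPoint φ).re = Real.cos (2 * φ) := exp_ofReal_mul_I_re _

lemma arcPoint_im (φ : ℝ) : (arcPoint φ).im = Real.sin (2 * φ) := exp_ofReal_mul_I_im _

lemma one_sub_arcPoint (φ : ℝ) :
    1 - arcPoint φ = (2 * Real.sin φ : ℝ) * (-I * exp (φ * I)) := by
  have h : arcPoint φ = exp (φ * I) * exp (φ * I) := by
    rw [arcPoint, ← exp_add]
    congr 1
    push_cast
    ring
  have h2 : exp (-(φ * I)) * exp (φ * I) = 1 := by rw [← exp_add]; simp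
  rw [h, ofReal_mul, ofReal_sin, Complex.sin, neg_mul]
  push_cast
  linear_combination (-1 : ℂ) * h2 + (exp (-(φ * I)) * exp (φ * I) - exp (φ * I) * exp (φ * I)) * I_sq

/-- The real trigonometric function governing the zeros of the theta series on `L_ρ`. -/
noncomputable def arcTrig (k : ℕ) (φ : ℝ) : ℝ :=
  2 * Real.cos (2 * k * φ) + (-1) ^ k * (2 * Real.sin φ) ^ (2 * k)

/-- Both 1 + e^{4ikφ} and (1 - e^{2iφ})^{2k} have phase e^{2ikφ} up to sign; what remains is real,
so zeros can be found from sign changes. -/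
lemma eval_lambdaPoly_arcPoint (k : ℕ) (φ : ℝ) :
    (lambdaPoly k).eval (arcPoint φ) = exp ((2 * k * φ : ℝ) * I) * arcTrig k φ := by
  have h1 : arcPoint φ ^ (2 * k) = exp ((2 * k * φ : ℝ) * I) * exp ((2 * k * φ : ℝ) * I) := by
    rw [arcPoint, ← exp_nat_mul, ← exp_add]
    congr 1
    push_cast
    ring
  have h2 : exp (φ * I) ^ (2 * k) = exp ((2 * k * φ : ℝ) * I) := by
    rw [← exp_nat_mul]
    congr 1
    push_cast
    ring
  have h3 : (-I) ^ (2 * k) = (-1) ^ k := by rw [pow_mul]; simp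
  have h4 : exp ((2 * k * φ : ℝ) * I) * exp (-((2 * k * φ : ℝ) * I)) = 1 := by
    rw [← exp_add]; simp
  rw [eval_lambdaPoly, h1, one_sub_arcPoint, mul_pow, mul_pow, h2, h3, arcTrig]
  push_cast at h4 ⊢
  rw [Complex.cos]
  rw [neg_mul, mul_add]
  linear_combination (-1 : ℂ) * h4

lemma isRoot_arcPoint_iff (k : ℕ) (φ : ℝ) :
    (lambdaPoly k).IsRoot (arcPoint φ) ↔ arcTrig k φ = 0 := by
  rw [IsRoot, eval_lambdaPoly_arcPoint]
  simp [exp_ne_zero]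

lemma arcPoint_injOn : InjOn arcPoint (Icc 0 (Real.pi / 2)) := by
  intro a ha b hb h
  have := congrArg Complex.re h
  rw [arcPoint_re, arcPoint_re] at this
  have := Real.injOn_cos (by constructor <;> linarith [ha.1, ha.2])
    (by constructor <;> linarith [hb.1, hb.2]) this
  linarith

lemma arcPoint_im_pos {φ : ℝ} (h : φ ∈ Ioo 0 (Real.pi / 6)) : 0 < (arcPoint φ).im := by
  rw [arcPoint_im]
  exact Real.sin_pos_of_pos_of_lt_pi (by linarith [h.1]) (by linarith [h.2, Real.pi_pos])

lemma two_sin_mem {φ : ℝ} (h : φ ∈ Icc 0 (Real.pi / 6)) : 2 * Real.sin φ ∈ Icc (0 : ℝ) 1 := by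
  constructor
  · have := Real.sin_nonneg_of_nonneg_of_le_pi h.1 (by linarith [h.2, Real.pi_pos])
    linarith
  · have := Real.sin_le_sin_of_le_of_le_pi_div_two (by linarith [h.1, Real.pi_pos])
      (by linarith [Real.pi_pos]) h.2
    rw [Real.sin_pi_div_six] at this
    linarith

lemma two_sin_mem_Ioo {φ : ℝ} (h : φ ∈ Ioo 0 (Real.pi / 6)) :
    2 * Real.sin φ ∈ Ioo (0 : ℝ) 1 := by
  constructor
  · have := Real.sin_pos_of_pos_of_lt_pi h.1 (by linarith [h.2, Real.pi_pos])
    linarith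
  · have := Real.sin_lt_sin_of_lt_of_le_pi_div_two (by linarith [h.1, Real.pi_pos])
      (by linarith [Real.pi_pos]) h.2
    rw [Real.sin_pi_div_six] at this
    linarith

lemma norm_one_sub_arcPoint {φ : ℝ} (h : 0 ≤ 2 * Real.sin φ) :
    ‖1 - arcPoint φ‖ = 2 * Real.sin φ := by
  rw [one_sub_arcPoint, norm_mul, norm_mul, norm_neg, norm_I, norm_exp_ofReal_mul_I, norm_real,
    Real.norm_of_nonneg h]
  ring

/-! ### Orbits under the anharmonic group and the root count. -/

/-- The points with positive imaginary part in the orbits of the `arcPoint φ`, `φ ∈ Z`, under the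
anharmonic group. -/
noncomputable def upperOrbit (Z : Finset ℝ) : Finset ℂ :=
  Z.image arcPoint ∪ Z.image (fun φ => 1 - starRingEnd ℂ (arcPoint φ)) ∪
    Z.image (fun φ => (1 - arcPoint φ)⁻¹)

lemma one_sub_arcPoint_norm_mem {φ : ℝ} (h : φ ∈ Ioo 0 (Real.pi / 6)) :
    0 < ‖1 - arcPoint φ‖ ∧ ‖1 - arcPoint φ‖ < 1 := by
  have := two_sin_mem_Ioo h
  rw [norm_one_sub_arcPoint this.1.le]
  exact this

lemma norm_one_sub_conj_arcPoint (φ : ℝ) :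
    ‖1 - starRingEnd ℂ (arcPoint φ)‖ = ‖1 - arcPoint φ‖ := by
  rw [← norm_conj (1 - arcPoint φ)]
  simp

lemma forall_upperOrbit {Z : Finset ℝ} {p : ℂ → Prop}
    (h1 : ∀ φ ∈ Z, p (arcPoint φ)) (h2 : ∀ φ ∈ Z, p (1 - starRingEnd ℂ (arcPoint φ)))
    (h3 : ∀ φ ∈ Z, p (1 - arcPoint φ)⁻¹) : ∀ z ∈ upperOrbit Z, p z := by
  intro z hz
  simp only [upperOrbit, Finset.mem_union, Finset.mem_image] at hz
  rcases hz with (⟨φ, hφ, rfl⟩ | ⟨φ, hφ, rfl⟩) | ⟨φ, hφ, rfl⟩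
  exacts [h1 φ hφ, h2 φ hφ, h3 φ hφ]

section

variable {Z : Finset ℝ} (hZ : ∀ φ ∈ Z, φ ∈ Ioo 0 (Real.pi / 6))

include hZ

lemma upperOrbit_im_pos : ∀ z ∈ upperOrbit Z, 0 < z.im := by
  refine forall_upperOrbit (fun φ hφ => arcPoint_im_pos (hZ φ hφ)) (fun φ hφ => ?_)
    (fun φ hφ => ?_)
  · simpa using arcPoint_im_pos (hZ φ hφ)
  · have h := arcPoint_im_pos (hZ φ hφ)
    rw [inv_im]
    refine div_pos (by simpa using h) (normSq_pos.mpr fun h0 => ?_)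
    have := (one_sub_arcPoint_norm_mem (hZ φ hφ)).1
    rw [h0, norm_zero] at this
    exact this.false

/-- The three families lie respectively on, inside and outside the unit circle, so they cannot meet.
-/
lemma card_upperOrbit : (upperOrbit Z).card = 3 * Z.card := by
  have hinj : ∀ φ ∈ Z, ∀ ψ ∈ Z, arcPoint φ = arcPoint ψ → φ = ψ := by
    intro φ hφ ψ hψ h
    refine arcPoint_injOn ⟨(hZ φ hφ).1.le, ?_⟩ ⟨(hZ ψ hψ).1.le, ?_⟩ h
    · linarith [(hZ φ hφ).2, Real.pi_pos]
    · linarith [(hZ ψ hψ).2, Real.pi_pos]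
  rw [upperOrbit, Finset.card_union_of_disjoint, Finset.card_union_of_disjoint,
    Finset.card_image_of_injOn, Finset.card_image_of_injOn, Finset.card_image_of_injOn]
  · ring
  · intro φ hφ ψ hψ h
    exact hinj φ hφ ψ hψ (sub_right_injective (inv_injective h))
  · intro φ hφ ψ hψ h
    exact hinj φ hφ ψ hψ ((starRingEnd ℂ).injective (sub_right_injective h))
  · intro φ hφ ψ hψ h
    exact hinj φ hφ ψ hψ h
  · rw [Finset.disjoint_left]
    intro z h1 h2
    obtain ⟨φ, hφ, rfl⟩ := Finset.mem_image.mp h1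
    obtain ⟨ψ, hψ, h⟩ := Finset.mem_image.mp h2
    have := congrArg norm h
    rw [norm_one_sub_conj_arcPoint, norm_arcPoint] at this
    linarith [(one_sub_arcPoint_norm_mem (hZ ψ hψ)).2]
  · rw [Finset.disjoint_left]
    intro z h1 h2
    obtain ⟨ψ, hψ, rfl⟩ := Finset.mem_image.mp h2
    have h3 : 1 < ‖(1 - arcPoint ψ)⁻¹‖ := by
      rw [norm_inv]
      exact (one_lt_inv₀ (one_sub_arcPoint_norm_mem (hZ ψ hψ)).1).mpr
        (one_sub_arcPoint_norm_mem (hZ ψ hψ)).2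
    rcases Finset.mem_union.mp h1 with h1 | h1 <;> obtain ⟨φ, hφ, h⟩ := Finset.mem_image.mp h1 <;>
      have := congrArg norm h
    · rw [norm_arcPoint] at this
      linarith
    · rw [norm_one_sub_conj_arcPoint] at this
      linarith [(one_sub_arcPoint_norm_mem (hZ φ hφ)).2]

lemma isRoot_of_mem_upperOrbit {k : ℕ} (hg : ∀ φ ∈ Z, arcTrig k φ = 0) :
    ∀ z ∈ upperOrbit Z, (lambdaPoly k).IsRoot z := by
  have h0 : ∀ φ ∈ Z, (lambdaPoly k).IsRoot (arcPoint φ) := fun φ hφ =>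
    (isRoot_arcPoint_iff k φ).mpr (hg φ hφ)
  refine forall_upperOrbit h0 (fun φ hφ => ?_) (fun φ hφ => ?_)
  · exact isRoot_lambdaPoly_one_sub (isRoot_lambdaPoly_conj (h0 φ hφ))
  · refine isRoot_lambdaPoly_inv ?_ (isRoot_lambdaPoly_one_sub (h0 φ hφ))
    exact norm_pos_iff.mp (one_sub_arcPoint_norm_mem (hZ φ hφ)).1

/-- This keeps the orbits out of the lens |z| < 1, |1 - z| < 1, so a root in the lens would be an
additional one. -/
lemma one_le_norm_of_mem_upperOrbit : ∀ z ∈ upperOrbit Z, 1 ≤ ‖z‖ ∨ 1 ≤ ‖1 - z‖ := by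
  refine forall_upperOrbit (fun φ hφ => ?_) (fun φ hφ => ?_) (fun φ hφ => ?_)
  · exact Or.inl (norm_arcPoint φ).ge
  · refine Or.inr ?_
    rw [sub_sub_cancel, norm_conj, norm_arcPoint]
  · refine Or.inl ?_
    rw [norm_inv]
    exact (one_le_inv₀ (one_sub_arcPoint_norm_mem (hZ φ hφ)).1).mpr
      (one_sub_arcPoint_norm_mem (hZ φ hφ)).2.le

lemma arcPoint_pi_div_six_notMem_upperOrbit : arcPoint (Real.pi / 6) ∉ upperOrbit Z := by
  intro h
  have key : ∀ z ∈ upperOrbit Z, z ≠ arcPoint (Real.pi / 6) := by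
    refine forall_upperOrbit (fun φ hφ h => ?_) (fun φ hφ h => ?_) (fun φ hφ h => ?_)
    · have h1 := hZ φ hφ
      have := arcPoint_injOn ⟨h1.1.le, by linarith [h1.2, Real.pi_pos]⟩
        ⟨by linarith [Real.pi_pos], by linarith [Real.pi_pos]⟩ h
      linarith [h1.2]
    · have := congrArg norm h
      rw [norm_one_sub_conj_arcPoint, norm_arcPoint] at this
      linarith [(one_sub_arcPoint_norm_mem (hZ φ hφ)).2]
    · have := congrArg norm h
      rw [norm_inv, norm_arcPoint, inv_eq_one] at this
      linarith [(one_sub_arcPoint_norm_mem (hZ φ hφ)).2]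
  exact key _ h rfl

end

lemma one_sub_arcPoint_pi_div_six :
    1 - arcPoint (Real.pi / 6) = (arcPoint (Real.pi / 6))⁻¹ := by
  rw [Complex.inv_def, normSq_eq_norm_sq, norm_arcPoint]
  have e : 2 * (Real.pi / 6) = Real.pi / 3 := by ring
  apply Complex.ext
  · simp [arcPoint_re, e, Real.cos_pi_div_three]
    norm_num
  · simp

lemma arcPoint_pi_div_six_pow_six : arcPoint (Real.pi / 6) ^ 6 = 1 := by
  rw [arcPoint, ← exp_nat_mul, ← exp_two_pi_mul_I]
  congr 1
  push_cast
  ring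

/-- The multiplicity of the root `exp (π i / 3)` is at least `k mod 3`. -/
lemma le_rootMultiplicity_arcPoint {k : ℕ} (hk : 1 ≤ k) :
    k % 3 ≤ (lambdaPoly k).rootMultiplicity (arcPoint (Real.pi / 6)) := by
  set e := arcPoint (Real.pi / 6) with he
  have h1 : 1 - e = e⁻¹ := one_sub_arcPoint_pi_div_six
  have h6 : e ^ 6 = 1 := arcPoint_pi_div_six_pow_six
  have h0 : e ≠ 0 := by
    intro h
    rw [h] at h6
    norm_num at h6
  have h2 : e ^ 2 = e - 1 := by
    have : (1 - e) * e = 1 := by rw [h1, inv_mul_cancel₀ h0]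
    linear_combination -this
  have h3 : e ^ 3 = -1 := by linear_combination (e + 1) * h2
  -- Here 1 - e = e⁻¹, so the value is 1 + ω + ω⁻¹ with ω = e^{2k}, a primitive cube root of unity
  -- unless 3 divides k.
  have hroot : k % 3 ≠ 0 → (lambdaPoly k).IsRoot e := by
    intro hk3
    rw [IsRoot, eval_lambdaPoly, h1, inv_pow]
    have hne : e ^ (2 * k) ≠ 0 := pow_ne_zero _ h0
    field_simp
    obtain ⟨m, hm | hm⟩ : ∃ m, k = 3 * m + 1 ∨ k = 3 * m + 2 := ⟨k / 3, by omega⟩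
    · have : e ^ (2 * k) = e ^ 2 := by
        rw [hm, show 2 * (3 * m + 1) = 6 * m + 2 by ring, pow_add, pow_mul, h6, one_pow, one_mul]
      rw [this]
      linear_combination (e ^ 2 + e + 1) * h2
    · have : e ^ (2 * k) = e ^ 4 := by
        rw [hm, show 2 * (3 * m + 2) = 6 * m + 4 by ring, pow_add, pow_mul, h6, one_pow, one_mul]
      rw [this]
      linear_combination (e ^ 2 + e + 1) * (e ^ 4 - e ^ 2 + 1) * h2
  have hP := lambdaPoly_ne_zero hk
  obtain h | h | h : k % 3 = 0 ∨ k % 3 = 1 ∨ k % 3 = 2 := by omega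
  · omega
  · rw [h]
    exact (rootMultiplicity_pos hP).mpr (hroot (by omega))
  · rw [h]
    refine (one_lt_rootMultiplicity_iff_isRoot hP).mpr ⟨hroot (by omega), ?_⟩
    have hd : derivative (lambdaPoly k) =
        C (2 * k : ℂ) * (X ^ (2 * k - 1) - (1 - X) ^ (2 * k - 1)) := by
      simp only [lambdaPoly, derivative_add, derivative_one, derivative_pow,
        derivative_sub, derivative_X]
      push_cast
      ring
    rw [IsRoot, hd]
    simp only [eval_mul, eval_C, eval_sub, eval_pow, eval_X, eval_one, h1, inv_pow]
    -- For k ≡ 2 mod 3 the exponent 2k - 1 is a multiple of 3; since e³ = -1, the powers of e and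
    -- e⁻¹ coincide and the derivative vanishes.
    obtain ⟨m, hm⟩ : ∃ m, 2 * k - 1 = 3 * m := ⟨(2 * k - 1) / 3, by omega⟩
    rw [hm, pow_mul, h3, ← inv_pow]
    simp

lemma le_rootMultiplicity_conj_arcPoint {k : ℕ} (hk : 1 ≤ k) :
    k % 3 ≤ (lambdaPoly k).rootMultiplicity (starRingEnd ℂ (arcPoint (Real.pi / 6))) := by
  have hmap : (lambdaPoly k).map (starRingEnd ℂ) = lambdaPoly k := by
    simp [lambdaPoly]
  have := Polynomial.eq_rootMultiplicity_map (p := lambdaPoly k) (f := starRingEnd ℂ)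
    (starRingEnd ℂ).injective (arcPoint (Real.pi / 6))
  rw [hmap] at this
  rw [← this]
  exact le_rootMultiplicity_arcPoint hk

lemma sum_rootMultiplicity_le {p : ℂ[X]} (T : Finset ℂ) :
    ∑ x ∈ T, p.rootMultiplicity x ≤ p.natDegree := by
  refine le_trans ?_ p.card_roots'
  rw [← Multiset.sum_count_eq_card (s := T ∪ p.roots.toFinset) (by simp_all)]
  simp only [count_roots]
  exact Finset.sum_le_sum_of_subset Finset.subset_union_left

/-- Counting the roots of `lambdaPoly k`: six for each zero of `arcTrig k` in `(0, π/6)`, the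
sixth roots of unity `exp (± π i / 3)` with their multiplicities, and any further ones. -/
lemma six_mul_card_add_le {k : ℕ} (hk : 1 ≤ k) {Z : Finset ℝ}
    (hZ : ∀ φ ∈ Z, φ ∈ Ioo 0 (Real.pi / 6)) (hg : ∀ φ ∈ Z, arcTrig k φ = 0) {X : Finset ℂ}
    (hX : ∀ z ∈ X, (lambdaPoly k).IsRoot z ∧ ‖z‖ < 1 ∧ ‖1 - z‖ < 1) :
    6 * Z.card + 2 * (k % 3) + X.card ≤ 2 * k := by
  set e := arcPoint (Real.pi / 6) with he
  set U := upperOrbit Z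
  set V := U.image (starRingEnd ℂ)
  have hP := lambdaPoly_ne_zero hk
  have heim : 0 < e.im := by
    rw [he, arcPoint_im]
    exact Real.sin_pos_of_pos_of_lt_pi (by linarith [Real.pi_pos]) (by linarith [Real.pi_pos])
  have hU := upperOrbit_im_pos hZ
  have hV : ∀ z ∈ V, z.im < 0 := by
    intro z hz
    obtain ⟨w, hw, rfl⟩ := Finset.mem_image.mp hz
    simpa using hU w hw
  have hUn := one_le_norm_of_mem_upperOrbit hZ
  have hVn : ∀ z ∈ V, 1 ≤ ‖z‖ ∨ 1 ≤ ‖1 - z‖ := by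
    intro z hz
    obtain ⟨w, hw, rfl⟩ := Finset.mem_image.mp hz
    rw [norm_conj, ← norm_conj (1 - _)]
    simpa using hUn w hw
  have hUroot := isRoot_of_mem_upperOrbit hZ hg
  have hVroot : ∀ z ∈ V, (lambdaPoly k).IsRoot z := by
    intro z hz
    obtain ⟨w, hw, rfl⟩ := Finset.mem_image.mp hz
    exact isRoot_lambdaPoly_conj (hUroot w hw)
  have heU : e ∉ U := arcPoint_pi_div_six_notMem_upperOrbit hZ
  have d1 : Disjoint U V := Finset.disjoint_left.mpr fun z h1 h2 => by
    linarith [hU z h1, hV z h2]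
  have d2 : Disjoint (U ∪ V) X := Finset.disjoint_left.mpr fun z h1 h2 => by
    obtain ⟨-, h3, h4⟩ := hX z h2
    rcases Finset.mem_union.mp h1 with h1 | h1
    · rcases hUn z h1 with h | h <;> linarith
    · rcases hVn z h1 with h | h <;> linarith
  have d3 : Disjoint (U ∪ V ∪ X) {e, starRingEnd ℂ e} := Finset.disjoint_right.mpr fun z h1 h2 => by
    have hz1 : ‖z‖ = 1 := by
      rcases Finset.mem_insert.mp h1 with rfl | h1
      · exact norm_arcPoint _
      · rw [Finset.mem_singleton.mp h1, norm_conj]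
        exact norm_arcPoint _
    rcases Finset.mem_union.mp h2 with h2 | h2
    · rcases Finset.mem_insert.mp h1 with rfl | h1
      · rcases Finset.mem_union.mp h2 with h2 | h2
        · exact heU h2
        · linarith [hV _ h2]
      · rw [Finset.mem_singleton.mp h1] at h2
        rcases Finset.mem_union.mp h2 with h2 | h2
        · have := hU _ h2
          rw [conj_im] at this
          linarith
        · obtain ⟨w, hw, h⟩ := Finset.mem_image.mp h2
          exact heU ((starRingEnd ℂ).injective h ▸ hw)
    · linarith [(hX z h2).2.1]
  have hsum := sum_rootMultiplicity_le (p := lambdaPoly k) (U ∪ V ∪ X ∪ {e, starRingEnd ℂ e})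
  have hne : e ≠ starRingEnd ℂ e := by
    intro h
    have := congrArg Complex.im h
    rw [conj_im] at this
    linarith
  rw [Finset.sum_union d3, Finset.sum_pair hne] at hsum
  have hcard : (U ∪ V ∪ X).card ≤ ∑ x ∈ U ∪ V ∪ X, (lambdaPoly k).rootMultiplicity x := by
    rw [Finset.card_eq_sum_ones]
    refine Finset.sum_le_sum fun z hz => (rootMultiplicity_pos hP).mpr ?_
    rcases Finset.mem_union.mp hz with hz | hz
    · rcases Finset.mem_union.mp hz with hz | hz
      exacts [hUroot z hz, hVroot z hz]
    · exact (hX z hz).1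
  rw [Finset.card_union_of_disjoint d2, Finset.card_union_of_disjoint d1,
    Finset.card_image_of_injective _ (starRingEnd ℂ).injective, card_upperOrbit hZ] at hcard
  have h1 := le_rootMultiplicity_arcPoint hk
  have h2 := le_rootMultiplicity_conj_arcPoint hk
  have h3 := natDegree_lambdaPoly_le k
  rw [← he] at h1 h2
  omega

/-- At jπ/(2k) the cosine term is 2(-1)^j, while the other term is at most 1 in absolute value
because 2 sin φ ≤ 1 up to π/6. The sign therefore alternates; m < k/3 keeps the right endpoint
within π/6. -/
lemma exists_arcTrig_zero {k : ℕ} (hk : 1 ≤ k) {m : ℕ} (hm : m < k / 3) :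
    ∃ φ ∈ Ioo (m * Real.pi / (2 * k)) ((m + 1) * Real.pi / (2 * k)), arcTrig k φ = 0 := by
  have hk0 : (0 : ℝ) < k := by exact_mod_cast hk
  have hval : ∀ j : ℕ, j ≤ k / 3 → |(-1) ^ j * arcTrig k (j * Real.pi / (2 * k)) - 2| ≤ 1 := by
    intro j hj
    have hj3 : (j : ℝ) * 3 ≤ k := by
      have : j * 3 ≤ k := by omega
      exact_mod_cast this
    have hmem : (j * Real.pi / (2 * k) : ℝ) ∈ Icc 0 (Real.pi / 6) := by
      constructor
      · positivity
      · rw [div_le_div_iff₀ (by positivity) (by norm_num)]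
        nlinarith [Real.pi_pos]
    have hs := two_sin_mem hmem
    have e : (2 * k * (j * Real.pi / (2 * k)) : ℝ) = j * Real.pi := by field_simp
    rw [arcTrig, e, Real.cos_nat_mul_pi]
    have e2 : (-1 : ℝ) ^ j * (2 * (-1) ^ j +
        (-1) ^ k * (2 * Real.sin (j * Real.pi / (2 * k))) ^ (2 * k)) - 2 =
        (-1) ^ j * (-1) ^ k * (2 * Real.sin (j * Real.pi / (2 * k))) ^ (2 * k) := by
      have : (-1 : ℝ) ^ j * (-1) ^ j = 1 := by rw [← mul_pow]; simp
      linear_combination 2 * this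
    rw [e2, abs_mul, abs_mul, abs_pow, abs_pow, abs_pow]
    simp only [abs_neg, abs_one, one_pow, one_mul]
    rw [abs_of_nonneg hs.1]
    exact pow_le_one₀ hs.1 hs.2
  have h1 := abs_le.mp (hval m hm.le)
  have h2 := abs_le.mp (hval (m + 1) hm)
  have hcont : Continuous fun φ => (-1 : ℝ) ^ m * arcTrig k φ := by
    unfold arcTrig
    fun_prop
  have hle : (m * Real.pi / (2 * k) : ℝ) ≤ (m + 1) * Real.pi / (2 * k) := by
    gcongr
    linarith
  rw [pow_succ] at h2
  push_cast at h2
  obtain ⟨φ, hφ, h0⟩ := intermediate_value_Ioo' hle hcont.continuousOn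
    (show (0 : ℝ) ∈ _ from ⟨by linarith [h2.1], by linarith [h1.1]⟩)
  refine ⟨φ, hφ, ?_⟩
  simpa using h0

/-- The zeros of `arcTrig k` in `(0, π/6)` are `⌊k/3⌋` in number, one in each of the consecutive
intervals of length `π/(2k)`, and they account for all the roots of `lambdaPoly k`. -/
theorem exists_arcTrig_zeros {k : ℕ} (hk : 1 ≤ k) : ∃ z : ℕ → ℝ,
    (∀ m < k / 3, z m ∈ Ioo (m * Real.pi / (2 * k)) ((m + 1) * Real.pi / (2 * k)) ∧
      z m ∈ Ioo 0 (Real.pi / 6) ∧ arcTrig k (z m) = 0) ∧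
    (∀ φ ∈ Ioo 0 (Real.pi / 6), arcTrig k φ = 0 → ∃ m < k / 3, z m = φ) ∧
    InjOn z (Iio (k / 3)) ∧
    ∀ x : ℂ, ‖x‖ < 1 → ‖1 - x‖ < 1 → ¬ (lambdaPoly k).IsRoot x := by
  have hk0 : (0 : ℝ) < k := by exact_mod_cast hk
  have hex : ∀ m, ∃ φ, m < k / 3 →
      φ ∈ Ioo (m * Real.pi / (2 * k)) ((m + 1) * Real.pi / (2 * k)) ∧ arcTrig k φ = 0 := by
    intro m
    by_cases hm : m < k / 3
    · obtain ⟨φ, h1, h2⟩ := exists_arcTrig_zero hk hm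
      exact ⟨φ, fun _ => ⟨h1, h2⟩⟩
    · exact ⟨0, fun h => absurd h hm⟩
  choose z hz using hex
  have hz6 : ∀ m < k / 3, z m ∈ Ioo 0 (Real.pi / 6) := by
    intro m hm
    obtain ⟨⟨h1, h2⟩, -⟩ := hz m hm
    refine ⟨lt_of_le_of_lt (by positivity) h1, h2.trans_le ?_⟩
    have hm3 : ((m : ℝ) + 1) * 3 ≤ k := by
      have : (m + 1) * 3 ≤ k := by omega
      exact_mod_cast this
    rw [div_le_div_iff₀ (by positivity) (by norm_num)]
    nlinarith [Real.pi_pos]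
  have hlt : ∀ m n, m < n → n < k / 3 → z m < z n := by
    intro m n hmn hn
    refine (hz m (hmn.trans hn)).1.2.trans (lt_of_le_of_lt ?_ (hz n hn).1.1)
    have : (m : ℝ) + 1 ≤ n := by exact_mod_cast hmn
    gcongr
  have hinj : InjOn z (Iio (k / 3)) := by
    intro m hm n hn h
    rcases lt_trichotomy m n with hmn | hmn | hmn
    · exact absurd h (hlt m n hmn hn).ne
    · exact hmn
    · exact absurd h (hlt n m hmn hm).ne'
  set Z := (Finset.range (k / 3)).image z
  have hcard : Z.card = k / 3 := by
    rw [Finset.card_image_of_injOn, Finset.card_range]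
    simpa using hinj
  have hZ : ∀ φ ∈ Z, φ ∈ Ioo 0 (Real.pi / 6) ∧ arcTrig k φ = 0 := by
    intro φ hφ
    obtain ⟨m, hm, rfl⟩ := Finset.mem_image.mp hφ
    have hm := Finset.mem_range.mp hm
    exact ⟨hz6 m hm, (hz m hm).2⟩
  refine ⟨z, fun m hm => ⟨(hz m hm).1, hz6 m hm, (hz m hm).2⟩, fun φ hφ h0 => ?_, hinj,
    fun x hx1 hx2 hx => ?_⟩
  -- The known roots already exhaust the degree, as 6⌊k/3⌋ + 2(k mod 3) = 2k. Another angle would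
  -- add six roots; a root in the lens would add one.
  · by_contra! hne
    have hnot : φ ∉ Z := by
      intro h
      obtain ⟨m, hm, h⟩ := Finset.mem_image.mp h
      exact hne m (Finset.mem_range.mp hm) h
    have := six_mul_card_add_le hk (Z := insert φ Z) (X := ∅)
      (fun ψ hψ => by
        rcases Finset.mem_insert.mp hψ with rfl | h
        exacts [hφ, (hZ ψ h).1])
      (fun ψ hψ => by
        rcases Finset.mem_insert.mp hψ with rfl | h
        exacts [h0, (hZ ψ h).2]) (by simp)
    rw [Finset.card_insert_of_notMem hnot, hcard] at this
    omega
  · have := six_mul_card_add_le hk (Z := Z) (X := {x}) (fun ψ hψ => (hZ ψ hψ).1)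
      (fun ψ hψ => (hZ ψ hψ).2) (by simpa using ⟨hx, hx1, hx2⟩)
    rw [Finset.card_singleton, hcard] at this
    omega

/-! ### The function λ and the density on the line Re τ = 1/2. -/

lemma deriv_oddRatio_zero : deriv oddRatio 0 = 2 := by
  have hpsi0 : psi 0 = 1 := by simp [psi]
  have h1 : HasDerivAt psi 2 0 := by
    rw [hasDerivAt_iff_isLittleO]
    have hO : (fun q : ℂ => psi q - psi 0 - (q - 0) • (2 : ℂ)) =O[𝓝 0] fun q => q ^ 2 := by
      refine Asymptotics.IsBigO.of_bound (8 / 3) ?_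
      filter_upwards [Metric.ball_mem_nhds (0 : ℂ) (show (0 : ℝ) < 1 / 4 by norm_num)] with q hq
      have hq : ‖q‖ ≤ 1 / 4 := by simpa using (mem_ball_zero_iff.mp hq).le
      have := norm_psi_sub_le_pow hq
      rw [hpsi0, sub_zero, smul_eq_mul, mul_comm q, norm_pow]
      refine this.trans ?_
      have := pow_le_pow_of_le_one (norm_nonneg q) (by linarith) (show 2 ≤ 4 by norm_num)
      linarith
    refine hO.trans_isLittleO ?_
    simpa using Asymptotics.isLittleO_pow_id (𝕜 := ℂ) (n := 2) (by norm_num)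
  have h2 : HasDerivAt (fun q => psi (-q)) (-2) 0 := by
    have h1' : HasDerivAt psi 2 (-0) := by simpa using h1
    simpa using! h1'.comp (0 : ℂ) (hasDerivAt_neg (0 : ℂ))
  have h3 := (h1.sub h2).div (h1.add h2) (by simp [hpsi0])
  have h4 : HasDerivAt oddRatio 2 0 := by
    refine h3.congr_deriv ?_
    simp [hpsi0]
    norm_num
  exact h4.deriv

lemma modularLambda_eq {τ : ℂ} (hτ : 1 / 2 < τ.im) : modularLambda τ =
    1 - ((1 - oddRatio (nome τ)) / (1 + oddRatio (nome τ))) ^ 4 := by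
  have hq := (norm_nome_lt_quarter hτ).le
  have h3 := jacobiTheta_ne_zero hτ
  have hJ := jacobi_identity (τ := τ) (by linarith)
  have hE := norm_pos_iff.mp (norm_psiEven_pos hq)
  have h1 := one_add_oddRatio_ne_zero hq
  have e : theta2 τ ^ 4 = jacobiTheta τ ^ 4 - theta4 τ ^ 4 := by rw [hJ]; ring
  rw [modularLambda, e, sub_div, div_self (pow_ne_zero _ h3), ← div_pow,
    jacobiTheta_eq_psiEven_mul hτ, theta4_eq_psiEven_mul hτ, mul_div_mul_left _ _ hE]

lemma one_sub_modularLambda {τ : ℂ} (hτ : 1 / 2 < τ.im) :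
    1 - modularLambda τ = theta4 τ ^ 4 / jacobiTheta τ ^ 4 := by
  have h3 := pow_ne_zero 4 (jacobiTheta_ne_zero hτ)
  have hJ := jacobi_identity (τ := τ) (by linarith)
  rw [modularLambda, eq_sub_iff_add_eq'.mpr hJ.symm, sub_div, div_self h3]

lemma latticeTheta_eq_zero_iff {k : ℕ} (hk : 1 ≤ k) {τ : ℂ} (hτ : 1 / 2 < τ.im) :
    latticeTheta (Gamma8 k) τ = 0 ↔ (lambdaPoly k).IsRoot (modularLambda τ) := by
  have h3 := pow_ne_zero 4 (jacobiTheta_ne_zero hτ)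
  have e : ∀ z : ℂ, z ^ (8 * k) = (z ^ 4) ^ (2 * k) := fun z => by
    rw [← pow_mul]
    congr 1
    ring
  have h : latticeTheta (Gamma8 k) τ =
      (jacobiTheta τ ^ 4) ^ (2 * k) / 2 * (lambdaPoly k).eval (modularLambda τ) := by
    rw [latticeTheta_Gamma8 hk (by linarith), eval_lambdaPoly, one_sub_modularLambda hτ,
      modularLambda, div_pow, div_pow, e, e, e]
    have := pow_ne_zero (2 * k) h3
    field_simp
    ring
  rw [h, Polynomial.IsRoot]
  simp [jacobiTheta_ne_zero hτ]

lemma hasDerivAt_nome (τ : ℂ) : HasDerivAt nome (Real.pi * I * nome τ) τ := by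
  have := ((hasDerivAt_id τ).const_mul (Real.pi * I : ℂ)).cexp
  simp only [mul_one, id] at this
  rw [mul_comm]
  exact this

/-- This is the logarithmic derivative of 1 - λ = ((1 - f)/(1 + f))⁴, namely -8f'/(1 - f²). -/
lemma deriv_modularLambda_div {τ : ℂ} (hτ : 1 / 2 < τ.im) :
    deriv modularLambda τ / (modularLambda τ - 1) =
      -(8 * (Real.pi * I * nome τ) * deriv oddRatio (nome τ) / (1 - oddRatio (nome τ) ^ 2)) := by
  have hq := norm_nome_lt_quarter hτ
  have h1 := one_add_oddRatio_ne_zero hq.le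
  have h2 := one_sub_oddRatio_ne_zero hq.le
  have hf : HasDerivAt (fun τ => oddRatio (nome τ))
      (deriv oddRatio (nome τ) * (Real.pi * I * nome τ)) τ :=
    (differentiableAt_oddRatio hq).hasDerivAt.comp τ (hasDerivAt_nome τ)
  have hd := (((hf.const_sub 1).div (hf.const_add 1) h1).pow 4).const_sub 1
  have heq : modularLambda =ᶠ[𝓝 τ] fun τ =>
      1 - ((1 - oddRatio (nome τ)) / (1 + oddRatio (nome τ))) ^ 4 := by
    filter_upwards [(isOpen_lt continuous_const continuous_im).mem_nhds hτ] with σ hσ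
    exact modularLambda_eq hσ
  rw [(hd.congr_of_eventuallyEq heq).deriv, modularLambda_eq hτ]
  have h3 : 1 - oddRatio (nome τ) ^ 2 ≠ 0 := by
    have : 1 - oddRatio (nome τ) ^ 2 = (1 - oddRatio (nome τ)) * (1 + oddRatio (nome τ)) := by ring
    rw [this]
    exact mul_ne_zero h2 h1
  simp only [Pi.div_apply]
  generalize oddRatio (nome τ) = f at *
  generalize deriv oddRatio (nome τ) = d
  have h4 : (1 - (((1 - f) / (1 + f)) ^ 4)) - 1 = -((1 - f) ^ 4 / (1 + f) ^ 4) := by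
    rw [div_pow]; ring
  rw [h4, div_pow]
  push_cast
  field_simp
  ring

lemma linePoint_im (y : ℝ) : (linePoint y).im = y := by simp [linePoint]

lemma linePoint_re (y : ℝ) : (linePoint y).re = 1 / 2 := by simp [linePoint]

lemma linePoint_injective : Function.Injective linePoint := fun x y h => by
  simpa [linePoint_im] using congrArg Complex.im h

lemma nome_linePoint (y : ℝ) : nome (linePoint y) = (Real.exp (-Real.pi * y) : ℝ) * I := by
  have : (Real.pi : ℂ) * I * (1 / 2 + y * I) = ((-Real.pi * y : ℝ) : ℂ) + Real.pi / 2 * I := by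
    push_cast
    linear_combination (Real.pi * y : ℂ) * I_sq
  rw [nome, linePoint, this, exp_add, exp_pi_div_two_mul_I, ofReal_exp]

/-- The real function `t` with `oddRatio (i s) = i t(s)`. -/
noncomputable def lineRatio (s : ℝ) : ℝ := (oddRatio (s * I)).im

lemma oddRatio_imaginary (s : ℝ) : oddRatio (s * I) = lineRatio s * I := by
  apply Complex.ext
  · simpa using oddRatio_re_imaginary s
  · simp [lineRatio]

lemma norm_ofReal_mul_I (s : ℝ) : ‖(s : ℂ) * I‖ = |s| := by simp

lemma hasDerivAt_oddRatio_imaginary {s : ℝ} (hs : |s| < 1 / 4) :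
    HasDerivAt (fun x : ℝ => oddRatio (x * I)) (deriv oddRatio (s * I) * I) s := by
  have h1 : HasDerivAt (fun x : ℝ => (x : ℂ) * I) I s := by
    simpa using (hasDerivAt_id s).ofReal_comp.mul_const I
  exact (differentiableAt_oddRatio (by rwa [norm_ofReal_mul_I])).hasDerivAt.comp s h1

lemma hasDerivAt_lineRatio {s : ℝ} (hs : |s| < 1 / 4) :
    HasDerivAt lineRatio (deriv oddRatio (s * I)).re s := by
  have h := (hasDerivAt_oddRatio_imaginary hs)
  have h2 := imCLM.hasFDerivAt.comp_hasDerivAt s h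
  simpa [lineRatio] using! h2

lemma deriv_oddRatio_im {s : ℝ} (hs : |s| < 1 / 4) : (deriv oddRatio (s * I)).im = 0 := by
  have h := (hasDerivAt_oddRatio_imaginary hs)
  have h2 := (hasDerivAt_lineRatio hs).ofReal_comp.mul_const I
  simp_rw [← oddRatio_imaginary] at h2
  have h3 := mul_right_cancel₀ I_ne_zero (h.unique h2)
  rw [h3, ofReal_im]

lemma deriv_oddRatio_re_pos {s : ℝ} (hs : |s| ≤ 1 / 10) : 0 < (deriv oddRatio (s * I)).re := by
  have h := norm_deriv_oddRatio_sub_le (q := s * I) (by rwa [norm_ofReal_mul_I])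
  have h2 := (abs_re_le_norm _).trans h
  rw [sub_re, abs_le] at h2
  simp at h2
  linarith [h2.1]

lemma lineRatio_zero : lineRatio 0 = 0 := by simp [lineRatio, oddRatio_zero]

lemma strictMonoOn_lineRatio : StrictMonoOn lineRatio (Icc 0 (1 / 10)) := by
  refine strictMonoOn_of_deriv_pos (convex_Icc _ _) (fun s hs => ?_) (fun s hs => ?_)
  · have : |s| < 1 / 4 := by rw [abs_of_nonneg hs.1]; linarith [hs.2]
    exact (hasDerivAt_lineRatio this).continuousAt.continuousWithinAt
  · rw [interior_Icc] at hs
    have : |s| ≤ 1 / 10 := by rw [abs_of_pos hs.1]; exact hs.2.le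
    rw [(hasDerivAt_lineRatio (by linarith)).deriv]
    exact deriv_oddRatio_re_pos this

/-- The angle `φ(y)` with `1 - λ(1/2 + i y) = exp (-2 i φ(y))`. -/
noncomputable def lineAngle (y : ℝ) : ℝ := 4 * Real.arctan (lineRatio (Real.exp (-Real.pi * y)))

lemma exp_lt_quarter {y : ℝ} (hy : 1 / 2 < y) : Real.exp (-Real.pi * y) < 1 / 4 := by
  have := norm_nome_lt_quarter (τ := linePoint y) (by rwa [linePoint_im])
  rwa [norm_nome, linePoint_im] at this

lemma exp_le_tenth {y : ℝ} (hy : 3 / 4 ≤ y) : Real.exp (-Real.pi * y) ≤ 1 / 10 := by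
  have := norm_nome_le_tenth (τ := linePoint y) (by rwa [linePoint_im])
  rwa [norm_nome, linePoint_im] at this

lemma one_sub_mul_I_div (t : ℝ) :
    (1 - t * I) / (1 + t * I) = exp (-(2 * Real.arctan t * I : ℂ)) := by
  have hc := (Real.cos_arctan_pos t).ne'
  have ht : (t : ℂ) = Complex.sin (Real.arctan t) / Complex.cos (Real.arctan t) := by
    rw [← ofReal_sin, ← ofReal_cos, ← ofReal_div, ← Real.tan_eq_sin_div_cos, Real.tan_arctan]
  have hc' : Complex.cos (Real.arctan t) ≠ 0 := by
    rw [← ofReal_cos]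
    exact_mod_cast hc
  have h1 : (1 - t * I) * Complex.cos (Real.arctan t) = exp (-(Real.arctan t * I)) := by
    rw [← neg_mul, exp_mul_I, Complex.cos_neg, Complex.sin_neg]
    nth_rewrite 1 [ht]
    field_simp
    ring
  have h2 : (1 + t * I) * Complex.cos (Real.arctan t) = exp (Real.arctan t * I) := by
    rw [exp_mul_I]
    nth_rewrite 1 [ht]
    field_simp
  rw [← mul_div_mul_right _ _ hc', h1, h2, ← exp_sub]
  congr 1
  ring

lemma one_sub_modularLambda_linePoint {y : ℝ} (hy : 1 / 2 < y) :
    1 - modularLambda (linePoint y) = starRingEnd ℂ (arcPoint (lineAngle y)) := by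
  rw [modularLambda_eq (by rwa [linePoint_im]), sub_sub_cancel, nome_linePoint,
    oddRatio_imaginary, one_sub_mul_I_div, ← exp_nat_mul, arcPoint, ← exp_conj, lineAngle]
  congr 1
  rw [map_mul, conj_ofReal, conj_I]
  push_cast
  ring

lemma isRoot_modularLambda_linePoint_iff {k : ℕ} {y : ℝ} (hy : 1 / 2 < y) :
    (lambdaPoly k).IsRoot (modularLambda (linePoint y)) ↔ arcTrig k (lineAngle y) = 0 := by
  rw [← isRoot_arcPoint_iff]
  have h := one_sub_modularLambda_linePoint hy
  constructor
  · intro h1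
    have := isRoot_lambdaPoly_conj (isRoot_lambdaPoly_one_sub h1)
    rwa [h, conj_conj] at this
  · intro h1
    have := isRoot_lambdaPoly_one_sub (isRoot_lambdaPoly_conj h1)
    rwa [← h, sub_sub_cancel] at this

lemma zeroDensity_eq {y : ℝ} (hy : 1 / 2 < y) : zeroDensity y =
    ((24 * Real.exp (-Real.pi * y) * (deriv oddRatio ((Real.exp (-Real.pi * y) : ℝ) * I)).re /
      (1 + lineRatio (Real.exp (-Real.pi * y)) ^ 2) : ℝ) : ℂ) := by
  have hs := exp_lt_quarter hy
  have hs' : |Real.exp (-Real.pi * y)| < 1 / 4 := by rwa [abs_of_pos (Real.exp_pos _)]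
  have hd : deriv oddRatio ((Real.exp (-Real.pi * y) : ℝ) * I) =
      ((deriv oddRatio ((Real.exp (-Real.pi * y) : ℝ) * I)).re : ℂ) := by
    apply Complex.ext
    · simp
    · simpa using deriv_oddRatio_im hs'
  rw [zeroDensity, deriv_modularLambda_div (by rwa [linePoint_im]), nome_linePoint,
    oddRatio_imaginary]
  nth_rewrite 1 [hd]
  generalize (deriv oddRatio ((Real.exp (-Real.pi * y) : ℝ) * I)).re = d
  generalize Real.exp (-Real.pi * y) = s
  generalize lineRatio s = t
  have h1 : (1 : ℂ) - (t * I) ^ 2 = 1 + t ^ 2 := by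
    linear_combination (-(t : ℂ) ^ 2) * I_sq
  have h2 : (1 : ℂ) + t ^ 2 ≠ 0 := by
    have : (0 : ℝ) < 1 + t ^ 2 := by positivity
    exact_mod_cast this.ne'
  have hpi : (Real.pi : ℂ) ≠ 0 := by exact_mod_cast Real.pi_ne_zero
  rw [h1]
  push_cast
  field_simp
  linear_combination (-24 * s * d : ℂ) * I_sq

/-- This identifies ϱ, up to the factor 6/π and a sign, with the rate of change of the angle; the
limiting measure is therefore uniform in the angle. -/
lemma hasDerivAt_lineAngle {y : ℝ} (hy : 1 / 2 < y) :
    HasDerivAt lineAngle (-(Real.pi / 6) * (zeroDensity y).re) y := by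
  have hs := exp_lt_quarter hy
  have hs' : |Real.exp (-Real.pi * y)| < 1 / 4 := by rwa [abs_of_pos (Real.exp_pos _)]
  have h1 : HasDerivAt (fun y : ℝ => Real.exp (-Real.pi * y))
      (Real.exp (-Real.pi * y) * -Real.pi) y := by
    simpa using ((hasDerivAt_id y).const_mul (-Real.pi)).exp
  have h2 := ((hasDerivAt_lineRatio hs').comp y h1).arctan.const_mul 4
  refine h2.congr_deriv ?_
  rw [zeroDensity_eq hy, ofReal_re]
  simp only [Function.comp]
  field_simp
  ring

lemma zeroDensity_im {y : ℝ} (hy : 1 / 2 < y) : (zeroDensity y).im = 0 := by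
  rw [zeroDensity_eq hy, ofReal_im]

lemma zeroDensity_re_pos {y : ℝ} (hy : 3 / 4 ≤ y) : 0 < (zeroDensity y).re := by
  rw [zeroDensity_eq (by linarith), ofReal_re]
  have := deriv_oddRatio_re_pos (s := Real.exp (-Real.pi * y))
    (by rw [abs_of_pos (Real.exp_pos _)]; exact exp_le_tenth hy)
  have := Real.exp_pos (-Real.pi * y)
  positivity

lemma strictAntiOn_lineAngle : StrictAntiOn lineAngle (Ici (3 / 4)) := by
  intro x hx y hy hxy
  refine mul_lt_mul_of_pos_left (Real.arctan_strictMono ?_) (by norm_num)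
  refine strictMonoOn_lineRatio ⟨(Real.exp_pos _).le, exp_le_tenth hy⟩
    ⟨(Real.exp_pos _).le, exp_le_tenth hx⟩ ?_
  rw [Real.exp_lt_exp]
  nlinarith [Real.pi_pos]

lemma lineRatio_exp_pos {y : ℝ} (hy : 3 / 4 ≤ y) : 0 < lineRatio (Real.exp (-Real.pi * y)) := by
  rw [← lineRatio_zero]
  exact strictMonoOn_lineRatio ⟨le_rfl, by norm_num⟩ ⟨(Real.exp_pos _).le, exp_le_tenth hy⟩
    (Real.exp_pos _)

lemma lineAngle_pos {y : ℝ} (hy : 3 / 4 ≤ y) : 0 < lineAngle y := by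
  have := Real.arctan_strictMono (lineRatio_exp_pos hy)
  rw [Real.arctan_zero] at this
  rw [lineAngle]
  linarith

/-- The line ratio is at most 17/80, less than π/8 < tan(π/8). The bound places the angle where sine
is injective, as needed to compute its value at ρ. -/
lemma lineAngle_lt_pi_div_two {y : ℝ} (hy : 3 / 4 ≤ y) : lineAngle y < Real.pi / 2 := by
  have h1 := exp_le_tenth hy
  have h2 := norm_oddRatio_le (q := (Real.exp (-Real.pi * y) : ℝ) * I)
    (by rwa [norm_ofReal_mul_I, abs_of_pos (Real.exp_pos _)])
  rw [oddRatio_imaginary, norm_ofReal_mul_I, norm_ofReal_mul_I, abs_of_pos (Real.exp_pos _),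
    abs_of_pos (lineRatio_exp_pos hy)] at h2
  have h3 : Real.arctan (lineRatio (Real.exp (-Real.pi * y))) < Real.pi / 8 := by
    have h4 := Real.pi_gt_three
    rw [← Real.arctan_tan (x := Real.pi / 8) (by linarith) (by linarith)]
    refine Real.arctan_strictMono ?_
    have := Real.lt_tan (x := Real.pi / 8) (by linarith) (by linarith)
    linarith
  rw [lineAngle]
  linarith

lemma tendsto_exp_neg_pi_mul : Tendsto (fun y : ℝ => Real.exp (-Real.pi * y)) atTop (𝓝 0) := by
  refine Real.tendsto_exp_atBot.comp ?_
  exact tendsto_id.const_mul_atTop_of_neg (by linarith [Real.pi_pos])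

lemma tendsto_lineRatio_exp :
    Tendsto (fun y : ℝ => lineRatio (Real.exp (-Real.pi * y))) atTop (𝓝 0) := by
  have h := (hasDerivAt_lineRatio (s := 0) (by norm_num)).continuousAt.tendsto
  rw [lineRatio_zero] at h
  exact h.comp tendsto_exp_neg_pi_mul

lemma tendsto_lineAngle : Tendsto lineAngle atTop (𝓝 0) := by
  have := ((Real.continuous_arctan.tendsto 0).comp tendsto_lineRatio_exp).const_mul 4
  rw [Real.arctan_zero, mul_zero] at this
  exact this

lemma three_quarters_lt_sqrt : 3 / 4 < Real.sqrt 3 / 2 := by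
  have : (3 / 2 : ℝ) < Real.sqrt 3 := Real.lt_sqrt_of_sq_lt (by norm_num)
  linarith

lemma rhoPoint_eq : rhoPoint = linePoint (Real.sqrt 3 / 2) := by
  have e : (Real.pi : ℂ) * I / 3 = ((Real.pi / 3 : ℝ) : ℂ) * I := by push_cast; ring
  rw [rhoPoint, e]
  apply Complex.ext
  · rw [exp_ofReal_mul_I_re, linePoint_re, Real.cos_pi_div_three]
  · rw [exp_ofReal_mul_I_im, linePoint_im, Real.sin_pi_div_three]

lemma rhoPoint_mul_sub_one : rhoPoint * (rhoPoint - 1) = -1 := by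
  have h3 : Real.sqrt 3 * Real.sqrt 3 = 3 := Real.mul_self_sqrt (by norm_num)
  rw [rhoPoint_eq, linePoint]
  apply Complex.ext
  · simp
    nlinarith
  · simp
    ring

/-- The point ρ is fixed by τ ↦ -1/(τ - 1), which yields θ₃(ρ)² = θ₂(ρ)θ₄(ρ). Since |1 - λ| = 1 on
the line gives |θ₄(ρ)| = |θ₃(ρ)|, also |θ₂(ρ)| = |θ₃(ρ)|. -/
lemma norm_modularLambda_rhoPoint : ‖modularLambda rhoPoint‖ = 1 := by
  have him : (3 : ℝ) / 4 < rhoPoint.im := by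
    rw [rhoPoint_eq, linePoint_im]
    exact three_quarters_lt_sqrt
  have h3 := jacobiTheta_ne_zero (τ := rhoPoint) (by linarith)
  have h := theta4_mul_jacobiTheta_neg_inv (rhoPoint - 1)
  have h0 : rhoPoint - 1 ≠ 0 := fun h0 => by
    have := congrArg Complex.im h0
    simp at this
    linarith
  have e : -1 / (rhoPoint - 1) = rhoPoint := by
    rw [div_eq_iff h0, rhoPoint_mul_sub_one]
  have e2 : jacobiTheta (rhoPoint - 1) = theta4 rhoPoint := by
    rw [← jacobiTheta_two_add, ← jacobiTheta_add_one]
    congr 1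
    ring
  rw [e, e2, ← jacobiTheta_add_one, sub_add_cancel] at h
  have h4 : ‖theta4 rhoPoint‖ = ‖jacobiTheta rhoPoint‖ := by
    have h5 := congrArg norm (one_sub_modularLambda (τ := rhoPoint) (by linarith))
    nth_rewrite 1 [rhoPoint_eq] at h5
    rw [one_sub_modularLambda_linePoint (by linarith [three_quarters_lt_sqrt]), norm_conj,
      norm_arcPoint, norm_div, eq_comm, div_eq_one_iff_eq (by simpa using h3), norm_pow,
      norm_pow] at h5
    exact (pow_left_inj₀ (norm_nonneg _) (norm_nonneg _) (by norm_num)).mp h5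
  have h5 := congrArg norm h
  rw [norm_mul, norm_mul, h4] at h5
  have h6 := mul_right_cancel₀ (norm_ne_zero_iff.mpr h3) h5
  rw [modularLambda, norm_div, norm_pow, norm_pow, ← h6, div_self]
  exact pow_ne_zero _ (norm_ne_zero_iff.mpr h3)

/-- At ρ, |λ| = |1 - e^{2iφ}| = 2 sin φ must equal 1. -/
lemma lineAngle_sqrt : lineAngle (Real.sqrt 3 / 2) = Real.pi / 6 := by
  have hy := three_quarters_lt_sqrt
  have h1 := lineAngle_pos hy.le
  have h2 := lineAngle_lt_pi_div_two hy.le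
  have h3 := norm_modularLambda_rhoPoint
  have h4 := one_sub_modularLambda_linePoint (y := Real.sqrt 3 / 2) (by linarith)
  have h5 : modularLambda rhoPoint = 1 - starRingEnd ℂ (arcPoint (lineAngle (Real.sqrt 3 / 2))) := by
    rw [← h4, rhoPoint_eq]
    ring
  have hsin := Real.sin_pos_of_pos_of_lt_pi h1 (by linarith)
  rw [h5, norm_one_sub_conj_arcPoint, norm_one_sub_arcPoint (by linarith)] at h3
  refine Real.injOn_sin ⟨by linarith, h2.le⟩ ⟨by linarith [Real.pi_pos], by linarith [Real.pi_pos]⟩ ?_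
  rw [Real.sin_pi_div_six]
  linarith

lemma lineAngle_image : lineAngle '' Ici (Real.sqrt 3 / 2) = Ioc 0 (Real.pi / 6) := by
  have hy := three_quarters_lt_sqrt
  apply Subset.antisymm
  · rintro _ ⟨y, hy', rfl⟩
    have hy' : Real.sqrt 3 / 2 ≤ y := hy'
    refine ⟨lineAngle_pos (hy.le.trans hy'), ?_⟩
    rw [← lineAngle_sqrt]
    exact strictAntiOn_lineAngle.antitoneOn hy.le (hy.le.trans hy') hy'
  · rintro φ ⟨h1, h2⟩
    obtain ⟨b, hb, hb2⟩ := ((tendsto_lineAngle.eventually_lt_const h1).and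
      (eventually_ge_atTop (Real.sqrt 3 / 2))).exists
    have hcont : ContinuousOn lineAngle (Icc (Real.sqrt 3 / 2) b) := fun y hy' =>
      (hasDerivAt_lineAngle (by linarith [hy'.1])).continuousAt.continuousWithinAt
    obtain ⟨y, hy1, hy2⟩ := intermediate_value_Icc' hb2 hcont
      (show φ ∈ _ from ⟨hb.le, by rwa [lineAngle_sqrt]⟩)
    exact ⟨y, hy1.1, hy2⟩

lemma isEquivalent_zeroDensity :
    Asymptotics.IsEquivalent atTop zeroDensity
      (fun y : ℝ => ((48 * Real.exp (-Real.pi * y) : ℝ) : ℂ)) := by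
  have hne : ∀ y : ℝ, ((48 * Real.exp (-Real.pi * y) : ℝ) : ℂ) ≠ 0 := fun y => by
    exact_mod_cast (mul_pos (by norm_num) (Real.exp_pos _)).ne'
  refine (Asymptotics.isEquivalent_iff_tendsto_one (Eventually.of_forall hne)).mpr ?_
  have h1 : Tendsto (fun y : ℝ => (deriv oddRatio ((Real.exp (-Real.pi * y) : ℝ) * I)).re)
      atTop (𝓝 2) := by
    have hc := (continuousAt_deriv_oddRatio (q := 0) (by norm_num)).tendsto
    rw [deriv_oddRatio_zero] at hc
    have hq : Tendsto (fun y : ℝ => ((Real.exp (-Real.pi * y) : ℝ) : ℂ) * I) atTop (𝓝 0) := by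
      simpa using ((continuous_ofReal.tendsto 0).comp tendsto_exp_neg_pi_mul).mul_const I
    exact (continuous_re.tendsto _).comp (hc.comp hq)
  have h2 := (h1.div ((tendsto_lineRatio_exp.pow 2).const_add 1) (by norm_num)).div_const 2
  have h3 := (continuous_ofReal.tendsto _).comp h2
  have e1 : (((2 / (1 + 0 ^ 2) / 2 : ℝ)) : ℂ) = 1 := by norm_num
  rw [e1] at h3
  refine h3.congr' ?_
  filter_upwards [eventually_gt_atTop (1 / 2)] with y hy
  have h4 := Real.exp_pos (-Real.pi * y)
  have h5 : (0 : ℝ) < 1 + lineRatio (Real.exp (-Real.pi * y)) ^ 2 := by positivity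
  simp only [Pi.div_apply, Function.comp]
  rw [zeroDensity_eq hy, ← ofReal_div]
  congr 1
  field_simp
  ring

end LatticeTheta

/-! ### Location of the zeros of the theta series. -/

namespace LatticeTheta

open Complex Filter Topology Set MeasureTheory

lemma sqrt_three_div_two_le_im {τ : ℂ} (hre : |τ.re| ≤ 1 / 2) (him : 0 < τ.im) (hn : 1 ≤ ‖τ‖) :
    Real.sqrt 3 / 2 ≤ τ.im := by
  have h1 : 1 ≤ τ.re ^ 2 + τ.im ^ 2 := by
    have : normSq τ = τ.re ^ 2 + τ.im ^ 2 := by rw [normSq_apply]; ring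
    rw [← this, normSq_eq_norm_sq]
    nlinarith
  have h2 : τ.re ^ 2 ≤ 1 / 4 := by
    rw [← sq_abs]
    nlinarith [abs_nonneg τ.re]
  have h3 : Real.sqrt 3 ≤ 2 * τ.im := Real.sqrt_le_iff.mpr ⟨by linarith, by nlinarith⟩
  linarith

lemma mem_fundDomain_cases {τ : ℂ} (h : τ ∈ fundDomain) :
    0 < τ.im ∧ 1 ≤ ‖τ‖ ∧ (|τ.re| < 1 / 2 ∨ τ.re = 1 / 2) := by
  rcases h with ⟨h1, h2, h3, h4⟩ | ⟨h1, h2, h3, h4⟩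
  · exact ⟨h1, h2.le, Or.inl (abs_lt.mpr ⟨h3, by linarith⟩)⟩
  · refine ⟨h1, h2, ?_⟩
    rcases h4.lt_or_eq with h | h
    · exact Or.inl (abs_lt.mpr ⟨by linarith, h⟩)
    · exact Or.inr h

lemma linePoint_mem_fundDomain {y : ℝ} (hy : Real.sqrt 3 / 2 ≤ y) : linePoint y ∈ fundDomain := by
  have h3 : Real.sqrt 3 ^ 2 = 3 := Real.sq_sqrt (by norm_num)
  have h0 := three_quarters_lt_sqrt
  refine Or.inr ⟨by rw [linePoint_im]; linarith, ?_, by norm_num [linePoint_re],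
    by rw [linePoint_re]⟩
  rw [← one_le_sq_iff₀ (norm_nonneg _), ← normSq_eq_norm_sq, normSq_apply, linePoint_im,
    linePoint_re]
  nlinarith

/-- The inverse of `lineAngle`, giving the height of the point of `L_ρ` with a given angle. -/
noncomputable def lineHeight : ℝ → ℝ := Function.invFunOn lineAngle (Ici (Real.sqrt 3 / 2))

lemma lineHeight_mem {φ : ℝ} (h : φ ∈ Ioc 0 (Real.pi / 6)) :
    Real.sqrt 3 / 2 ≤ lineHeight φ ∧ lineAngle (lineHeight φ) = φ := by
  rw [← lineAngle_image] at h
  exact ⟨Function.invFunOn_mem h, Function.invFunOn_eq h⟩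

lemma strictAntiOn_lineAngle_Ici : StrictAntiOn lineAngle (Ici (Real.sqrt 3 / 2)) :=
  strictAntiOn_lineAngle.mono (Ici_subset_Ici.mpr three_quarters_lt_sqrt.le)

lemma lineHeight_lineAngle {y : ℝ} (hy : Real.sqrt 3 / 2 ≤ y) : lineHeight (lineAngle y) = y :=
  strictAntiOn_lineAngle_Ici.injOn.leftInvOn_invFunOn hy

lemma sqrt_lt_lineHeight {φ : ℝ} (h : φ ∈ Ioo 0 (Real.pi / 6)) :
    Real.sqrt 3 / 2 < lineHeight φ := by
  obtain ⟨h1, h2⟩ := lineHeight_mem ⟨h.1, h.2.le⟩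
  refine h1.lt_of_ne fun h3 => ?_
  rw [← h3, lineAngle_sqrt] at h2
  exact h.2.ne h2.symm

/-- The inverse of a strictly decreasing function onto an interval is continuous; the order bounds
are transported through the angle. -/
lemma continuousAt_lineHeight {φ : ℝ} (h : φ ∈ Ioo 0 (Real.pi / 6)) :
    ContinuousAt lineHeight φ := by
  have h1 := sqrt_lt_lineHeight h
  have h2 := (lineHeight_mem ⟨h.1, h.2.le⟩).2
  have hnhds := Ioo_mem_nhds h.1 h.2
  refine tendsto_order.mpr ⟨fun a ha => ?_, fun b hb => ?_⟩
  · have hc : lineHeight φ > max a (Real.sqrt 3 / 2) := max_lt ha h1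
    have := strictAntiOn_lineAngle_Ici (le_max_right a _) h1.le hc
    rw [h2] at this
    filter_upwards [hnhds, Iio_mem_nhds this] with ψ hψ hlt
    obtain ⟨h3, h4⟩ := lineHeight_mem ⟨hψ.1, hψ.2.le⟩
    refine (le_max_left a (Real.sqrt 3 / 2)).trans_lt ?_
    by_contra! hle
    have := strictAntiOn_lineAngle_Ici.antitoneOn h3 (le_max_right a _) hle
    rw [h4] at this
    exact absurd hlt (not_lt.mpr this)
  · have := strictAntiOn_lineAngle_Ici h1.le (h1.trans hb).le hb
    rw [h2] at this
    filter_upwards [hnhds, Ioi_mem_nhds this] with ψ hψ hlt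
    obtain ⟨h3, h4⟩ := lineHeight_mem ⟨hψ.1, hψ.2.le⟩
    by_contra! hle
    have := strictAntiOn_lineAngle_Ici.antitoneOn (h1.trans hb).le h3 hle
    rw [h4] at this
    exact absurd hlt (not_lt.mpr this)

/-- The zeros of `arcTrig k` in `(0, π/6)`, in increasing order. -/
noncomputable def arcZero (k : ℕ) : ℕ → ℝ :=
  if hk : 1 ≤ k then Classical.choose (exists_arcTrig_zeros hk) else 0

lemma arcZero_spec {k : ℕ} (hk : 1 ≤ k) :
    (∀ m < k / 3, arcZero k m ∈ Ioo (m * Real.pi / (2 * k)) ((m + 1) * Real.pi / (2 * k)) ∧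
      arcZero k m ∈ Ioo 0 (Real.pi / 6) ∧ arcTrig k (arcZero k m) = 0) ∧
    (∀ φ ∈ Ioo 0 (Real.pi / 6), arcTrig k φ = 0 → ∃ m < k / 3, arcZero k m = φ) ∧
    InjOn (arcZero k) (Iio (k / 3)) ∧
    ∀ x : ℂ, ‖x‖ < 1 → ‖1 - x‖ < 1 → ¬ (lambdaPoly k).IsRoot x := by
  rw [arcZero, dif_pos hk]
  exact Classical.choose_spec (exists_arcTrig_zeros hk)

/-- The heights of the zeros of the theta series on `L_ρ`. -/
noncomputable def zeroHeight (k m : ℕ) : ℝ := lineHeight (arcZero k m)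

lemma zeroHeight_injOn {k : ℕ} (hk : 1 ≤ k) : InjOn (zeroHeight k) (Iio (k / 3)) := by
  intro m hm n hn h
  obtain ⟨h1, -, h2, -⟩ := arcZero_spec hk
  have := congrArg lineAngle h
  rw [zeroHeight, zeroHeight, (lineHeight_mem (Ioo_subset_Ioc_self (h1 m hm).2.1)).2,
    (lineHeight_mem (Ioo_subset_Ioc_self (h1 n hn).2.1)).2] at this
  exact h2 hm hn this

/-- Here λ lies in the lens |x| < 1, |1 - x| < 1, which the root count has shown to be free of
roots. -/
lemma latticeTheta_ne_zero {k : ℕ} (hk : 1 ≤ k) {τ : ℂ} (hre : |τ.re| < 1 / 2) (him : 0 < τ.im)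
    (hn : 1 ≤ ‖τ‖) : latticeTheta (Gamma8 k) τ ≠ 0 := by
  have h1 := sqrt_three_div_two_le_im hre.le him hn
  have h2 := three_quarters_lt_sqrt
  have h3 : 1 / 2 < τ.im := by linarith
  have h4 : 0 < ‖jacobiTheta τ‖ := norm_pos_iff.mpr (jacobiTheta_ne_zero h3)
  intro h
  refine (arcZero_spec hk).2.2.2 _ ?_ ?_ ((latticeTheta_eq_zero_iff hk h3).mp h)
  · rw [modularLambda, ← div_pow, norm_pow, norm_div]
    exact pow_lt_one₀ (by positivity) ((div_lt_one h4).mpr (norm_theta2_lt hre him hn)) (by norm_num)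
  · rw [one_sub_modularLambda h3, ← div_pow, norm_pow, norm_div]
    exact pow_lt_one₀ (by positivity)
      ((div_lt_one h4).mpr (norm_theta4_lt hre (by linarith))) (by norm_num)

theorem thetaZeros_eq {k : ℕ} (hk : 1 ≤ k) :
    thetaZeros k = (fun m => linePoint (zeroHeight k m)) '' Iio (k / 3) := by
  obtain ⟨hz, hz2, -, -⟩ := arcZero_spec hk
  have hs := three_quarters_lt_sqrt
  ext τ
  constructor
  · rintro ⟨hτ, hne, h0⟩
    obtain ⟨him, hn, hre | hre⟩ := mem_fundDomain_cases hτ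
    · exact absurd h0 (latticeTheta_ne_zero hk hre him hn)
    · have hy := sqrt_three_div_two_le_im (by rw [hre, abs_of_pos (by norm_num)]) him hn
      have hτ2 : τ = linePoint τ.im := by
        apply Complex.ext
        · rw [linePoint_re, hre]
        · rw [linePoint_im]
      have hy1 : 1 / 2 < τ.im := by linarith
      rw [latticeTheta_eq_zero_iff hk hy1, hτ2, isRoot_modularLambda_linePoint_iff hy1] at h0
      have hmem : lineAngle τ.im ∈ Ioc 0 (Real.pi / 6) := lineAngle_image ▸ mem_image_of_mem _ hy
      have hlt : lineAngle τ.im < Real.pi / 6 := by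
        refine hmem.2.lt_of_ne fun h => hne ?_
        rw [hτ2, rhoPoint_eq]
        congr 1
        exact strictAntiOn_lineAngle_Ici.injOn hy self_mem_Ici (h.trans lineAngle_sqrt.symm)
      obtain ⟨m, hm, h⟩ := hz2 _ ⟨hmem.1, hlt⟩ h0
      refine ⟨m, hm, ?_⟩
      simp only [zeroHeight]
      rw [h, lineHeight_lineAngle hy, ← hτ2]
  · rintro ⟨m, hm, rfl⟩
    obtain ⟨-, h1, h2⟩ := hz m hm
    have h3 : Real.sqrt 3 / 2 < zeroHeight k m := sqrt_lt_lineHeight h1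
    refine ⟨linePoint_mem_fundDomain h3.le, fun h => ?_, ?_⟩
    · rw [rhoPoint_eq] at h
      exact h3.ne' (linePoint_injective h)
    · rw [latticeTheta_eq_zero_iff hk (by rw [linePoint_im]; linarith),
        isRoot_modularLambda_linePoint_iff (by linarith), zeroHeight,
        (lineHeight_mem (Ioo_subset_Ioc_self h1)).2]
      exact h2

lemma linePoint_zeroHeight_injOn {k : ℕ} (hk : 1 ≤ k) :
    InjOn (fun m => linePoint (zeroHeight k m)) (Iio (k / 3)) := fun _ hm _ hn h =>
  zeroHeight_injOn hk hm hn (linePoint_injective h)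

/-! ### Equidistribution. -/

/-- Averages become integrals of step functions over a fixed interval, so that dominated convergence
applies. -/
lemma integral_comp_floor (G : ℕ → ℝ) {l : ℕ} (hl : 0 < l) :
    ∫ t in (0 : ℝ)..1, G ⌊t * l⌋₊ = (∑ m ∈ Finset.range l, G m) / l := by
  have hl0 : (l : ℝ) ≠ 0 := by exact_mod_cast hl.ne'
  rw [intervalIntegral.integral_comp_mul_right (fun s => G ⌊s⌋₊) hl0, zero_mul, one_mul,
    smul_eq_mul, inv_mul_eq_div]
  congr 1
  have hpiece : ∀ m : ℕ, EqOn (fun s : ℝ => G ⌊s⌋₊) (fun _ => G m) (Ioo (m : ℝ) ((m + 1 : ℕ) : ℝ)) := by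
    intro m s hs
    have : ⌊s⌋₊ = m := (Nat.floor_eq_iff (m.cast_nonneg.trans hs.1.le)).mpr
      ⟨hs.1.le, by exact_mod_cast hs.2⟩
    simp only [this]
  have hle : ∀ m : ℕ, (m : ℝ) ≤ ((m + 1 : ℕ) : ℝ) := fun m => by exact_mod_cast m.le_succ
  have hint : ∀ m : ℕ, IntervalIntegrable (fun s : ℝ => G ⌊s⌋₊) volume (m : ℝ) ((m + 1 : ℕ) : ℝ) := by
    intro m
    rw [intervalIntegrable_iff_integrableOn_Ioo_of_le (hle m)]
    exact (integrableOn_const (by simp)).congr_fun (hpiece m).symm measurableSet_Ioo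
  have := intervalIntegral.sum_integral_adjacent_intervals (μ := volume)
    (f := fun s : ℝ => G ⌊s⌋₊) (a := fun m : ℕ => (m : ℝ)) (n := l) fun m _ => hint m
  rw [Nat.cast_zero] at this
  rw [← this]
  refine Finset.sum_congr rfl fun m _ => ?_
  rw [intervalIntegral.integral_of_le (hle m), integral_Ioc_eq_integral_Ioo,
    setIntegral_congr_fun measurableSet_Ioo (hpiece m)]
  simp

/-- With m = ⌊t⌊k/3⌋⌋, the zero lies between mπ/(2k) and (m+1)π/(2k), while πt/6 lies between
mπ/(2k) and (m+2)π/(2k); the stated bound leaves room. -/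
lemma abs_arcZero_floor_sub_le {k : ℕ} (hk : 3 ≤ k) {t : ℝ} (ht : t ∈ Ioo (0 : ℝ) 1) :
    |arcZero k ⌊t * (k / 3 : ℕ)⌋₊ - Real.pi / 6 * t| ≤ Real.pi * (2 / k) := by
  have hl : 0 < k / 3 := by omega
  have hl0 : (0 : ℝ) < (k / 3 : ℕ) := by exact_mod_cast hl
  have hk0 : (0 : ℝ) < k := by exact_mod_cast (by omega : 0 < k)
  set m := ⌊t * (k / 3 : ℕ)⌋₊
  have hm : m < k / 3 := by
    rw [Nat.floor_lt (by have := ht.1; positivity)]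
    nlinarith [ht.2]
  have h1 : (m : ℝ) ≤ t * (k / 3 : ℕ) := Nat.floor_le (by have := ht.1; positivity)
  have h2 : t * (k / 3 : ℕ) < m + 1 := Nat.lt_floor_add_one _
  have h3 : ((k / 3 : ℕ) : ℝ) * 3 ≤ k := by exact_mod_cast (by omega : k / 3 * 3 ≤ k)
  have h4 : (k : ℝ) ≤ ((k / 3 : ℕ) : ℝ) * 3 + 2 := by exact_mod_cast (by omega : k ≤ k / 3 * 3 + 2)
  obtain ⟨h5, h6⟩ := ((arcZero_spec (by omega)).1 m hm).1
  have hpi := Real.pi_pos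
  rw [div_lt_iff₀ (by positivity)] at h5
  rw [lt_div_iff₀ (by positivity)] at h6
  have e : Real.pi * (2 / k) = Real.pi * 4 / (2 * k) := by field_simp; norm_num
  have e2 : arcZero k m - Real.pi / 6 * t =
      (arcZero k m * (2 * k) - Real.pi * (t * k / 3)) / (2 * k) := by
    field_simp
    ring
  rw [e, e2, abs_div, abs_of_pos (by positivity : (0 : ℝ) < 2 * k)]
  gcongr
  have h7 : t * k / 3 ≤ m + 2 := by nlinarith [ht.1, ht.2]
  have h8 : m ≤ t * k / 3 := by nlinarith [ht.1, ht.2]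
  rw [abs_le]
  constructor <;> nlinarith

/-- Equidistribution of the zeros, tested on bounded functions of the height that are continuous
outside a countable set. -/
theorem tendsto_average_zeroHeight {F : ℝ → ℝ} {C : ℝ} (hC : ∀ y, |F y| ≤ C) {D : Set ℝ}
    (hD : D.Countable) (hF : ∀ y, y ∉ D → ContinuousAt F y) :
    Tendsto (fun k : ℕ => (∑ m ∈ Finset.range (k / 3), F (zeroHeight k m)) / ((k / 3 : ℕ) : ℝ)) atTop
      (𝓝 (∫ y in Ici (Real.sqrt 3 / 2), F y * (zeroDensity y).re)) := by
  have hs := three_quarters_lt_sqrt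
  have hpi := Real.pi_pos
  -- change of variables
  have hcv : ∫ y in Ici (Real.sqrt 3 / 2), F y * (zeroDensity y).re =
      ∫ t in (0 : ℝ)..1, F (lineHeight (Real.pi / 6 * t)) := by
    have himg : (fun y => 6 / Real.pi * lineAngle y) '' Ici (Real.sqrt 3 / 2) = Ioc 0 1 := by
      rw [← image_image (fun x => 6 / Real.pi * x) lineAngle, lineAngle_image,
        image_mul_left_Ioc (by positivity)]
      congr 1
      · simp
      · field_simp
    have hder : ∀ y ∈ Ici (Real.sqrt 3 / 2), HasDerivWithinAt (fun y => 6 / Real.pi * lineAngle y)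
        (-(zeroDensity y).re) (Ici (Real.sqrt 3 / 2)) y := by
      intro y hy
      have hy : Real.sqrt 3 / 2 ≤ y := hy
      refine (((hasDerivAt_lineAngle (y := y) (by linarith)).const_mul (6 / Real.pi)).congr_deriv
        ?_).hasDerivWithinAt
      field_simp
    have hinj : InjOn (fun y => 6 / Real.pi * lineAngle y) (Ici (Real.sqrt 3 / 2)) := by
      intro x hx y hy h
      exact strictAntiOn_lineAngle_Ici.injOn hx hy (mul_left_cancel₀ (by positivity) h)
    have := integral_image_eq_integral_abs_deriv_smul measurableSet_Ici hder hinj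
      (fun t => F (lineHeight (Real.pi / 6 * t)))
    rw [intervalIntegral.integral_of_le zero_le_one, ← himg, this]
    refine setIntegral_congr_fun measurableSet_Ici fun y hy => ?_
    have hy : Real.sqrt 3 / 2 ≤ y := hy
    have e : Real.pi / 6 * (6 / Real.pi * lineAngle y) = lineAngle y := by field_simp
    rw [e, lineHeight_lineAngle hy, abs_neg, abs_of_pos (zeroDensity_re_pos (by linarith)),
      smul_eq_mul, mul_comm]
  have hsum : ∀ᶠ k : ℕ in atTop, ∫ t in (0 : ℝ)..1, F (zeroHeight k ⌊t * (k / 3 : ℕ)⌋₊) =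
      (∑ m ∈ Finset.range (k / 3), F (zeroHeight k m)) / ((k / 3 : ℕ) : ℝ) := by
    filter_upwards [eventually_ge_atTop 3] with k hk
    exact integral_comp_floor (fun m => F (zeroHeight k m)) (by omega)
  rw [hcv]
  refine Tendsto.congr' hsum ?_
  refine intervalIntegral.tendsto_integral_filter_of_dominated_convergence (fun _ => C)
    (Eventually.of_forall fun k => ?_) (Eventually.of_forall fun k => ae_of_all _ fun t _ => hC _)
    (by simp) ?_
  · refine Measurable.aestronglyMeasurable ?_
    exact (measurable_from_nat (f := fun m => F (zeroHeight k m))).comp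
      (Nat.measurable_floor.comp (measurable_id.mul_const _))
  -- The exceptional parameters are the countably many that correspond to discontinuities of F, and
  -- t = 1, where the angle reaches the endpoint π/6 and `continuousAt_lineHeight` does not apply.
  · have hnull : volume ((fun y => 6 / Real.pi * lineAngle y) '' D ∪ {1}) = 0 :=
      ((hD.image _).union (countable_singleton 1)).measure_zero _
    filter_upwards [compl_mem_ae_iff.mpr hnull] with t ht ht01
    rw [uIoc_of_le zero_le_one] at ht01
    have ht1 : t ∈ Ioo (0 : ℝ) 1 := ⟨ht01.1, ht01.2.lt_of_ne fun h => ht (Or.inr h)⟩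
    have hφ : Real.pi / 6 * t ∈ Ioo 0 (Real.pi / 6) :=
      ⟨mul_pos (by positivity) ht1.1, by nlinarith [ht1.2]⟩
    have hnot : lineHeight (Real.pi / 6 * t) ∉ D := by
      intro h
      refine ht (Or.inl ⟨_, h, ?_⟩)
      simp only
      rw [(lineHeight_mem (Ioo_subset_Ioc_self hφ)).2]
      field_simp
    refine (hF _ hnot).tendsto.comp ((continuousAt_lineHeight hφ).tendsto.comp ?_)
    rw [tendsto_iff_norm_sub_tendsto_zero]
    have hlim : Tendsto (fun k : ℕ => Real.pi * (2 / k)) atTop (𝓝 0) := by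
      simpa using (tendsto_const_div_atTop_nhds_zero_nat 2).const_mul Real.pi
    refine squeeze_zero' (Eventually.of_forall fun _ => norm_nonneg _) ?_ hlim
    filter_upwards [eventually_ge_atTop 3] with k hk
    exact abs_arcZero_floor_sub_le hk ht1

lemma thetaZeros_encard {k : ℕ} (hk : 1 ≤ k) : (thetaZeros k).encard = ((k / 3 : ℕ) : ℕ∞) := by
  rw [thetaZeros_eq hk, (linePoint_zeroHeight_injOn hk).encard_image, ← Finset.coe_range (k / 3),
    encard_coe_eq_coe_finsetCard, Finset.card_range]

lemma thetaZeros_subset_lineRho {k : ℕ} (hk : 1 ≤ k) : thetaZeros k ⊆ lineRho := by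
  rw [thetaZeros_eq hk]
  rintro _ ⟨m, hm, rfl⟩
  exact ⟨_, (sqrt_lt_lineHeight ((arcZero_spec hk).1 m hm).2.1).le, rfl⟩

lemma finsum_thetaZeros {k : ℕ} (hk : 1 ≤ k) (f : ℂ → ℝ) :
    ∑ᶠ τ ∈ thetaZeros k, f τ = ∑ m ∈ Finset.range (k / 3), f (linePoint (zeroHeight k m)) := by
  rw [thetaZeros_eq hk, finsum_mem_image (linePoint_zeroHeight_injOn hk), ← Finset.coe_range (k / 3),
    finsum_mem_coe_finset]

lemma ncard_thetaZeros_Icc {k : ℕ} (hk : 1 ≤ k) (a b : ℝ) :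
    (({τ ∈ thetaZeros k | τ.im ∈ Icc a b}.ncard : ℕ) : ℝ) =
      ∑ m ∈ Finset.range (k / 3), (Icc a b).indicator 1 (zeroHeight k m) := by
  classical
  have : {τ ∈ thetaZeros k | τ.im ∈ Icc a b} = (fun m => linePoint (zeroHeight k m)) ''
      ((Finset.range (k / 3)).filter fun m => zeroHeight k m ∈ Icc a b : Finset ℕ) := by
    rw [thetaZeros_eq hk]
    ext τ
    simp only [mem_ofPred_eq, mem_image, Finset.coe_filter, Finset.mem_range, mem_Iio]
    constructor
    · rintro ⟨⟨m, hm, rfl⟩, h⟩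
      rw [linePoint_im] at h
      exact ⟨m, ⟨hm, h⟩, rfl⟩
    · rintro ⟨m, ⟨hm, h⟩, rfl⟩
      exact ⟨⟨m, hm, rfl⟩, by rwa [linePoint_im]⟩
  rw [this, InjOn.ncard_image, ncard_coe_finset, Finset.card_filter]
  · push_cast
    refine Finset.sum_congr rfl fun m _ => ?_
    simp [indicator_apply]
  · refine (linePoint_zeroHeight_injOn hk).mono fun m hm => ?_
    simp only [Finset.coe_filter, Finset.mem_range, mem_ofPred_eq] at hm
    exact hm.1

lemma tendsto_interval {a b : ℝ} (ha : Real.sqrt 3 / 2 ≤ a) (hab : a ≤ b) :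
    Tendsto (fun k : ℕ => (({τ ∈ thetaZeros k | τ.im ∈ Icc a b}.ncard : ℕ) : ℝ) / ((k / 3 : ℕ) : ℝ))
      atTop (𝓝 (∫ y in a..b, (zeroDensity y).re)) := by
  -- An interval indicator is discontinuous only at its two endpoints.
  have h := tendsto_average_zeroHeight (F := (Icc a b).indicator 1) (C := 1) (D := {a, b})
    (fun y => by by_cases hy : y ∈ Icc a b <;> simp [hy]) (toFinite _).countable (fun y hy => ?_)
  · have e : ∫ y in Ici (Real.sqrt 3 / 2), (Icc a b).indicator 1 y * (zeroDensity y).re =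
        ∫ y in a..b, (zeroDensity y).re := by
      rw [intervalIntegral.integral_of_le hab, ← integral_Icc_eq_integral_Ioc]
      have : ∀ y, (Icc a b).indicator 1 y * (zeroDensity y).re =
          (Icc a b).indicator (fun y => (zeroDensity y).re) y := fun y => by
        by_cases hy : y ∈ Icc a b <;> simp [hy]
      simp_rw [this]
      rw [setIntegral_indicator measurableSet_Icc, inter_eq_self_of_subset_right]
      exact fun y hy => ha.trans hy.1
    rw [e] at h
    refine h.congr' ?_
    filter_upwards [eventually_ge_atTop 1] with k hk
    rw [ncard_thetaZeros_Icc hk]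
  · have hy1 : y ≠ a := fun h => hy (by simp [h])
    have hy2 : y ≠ b := fun h => hy (by simp [h])
    by_cases hmem : y ∈ Icc a b
    · have : Icc a b ∈ 𝓝 y :=
        Icc_mem_nhds (hmem.1.lt_of_ne hy1.symm) (hmem.2.lt_of_ne hy2)
      refine (continuousAt_const (y := (1 : ℝ))).congr ?_
      filter_upwards [this] with x hx
      simp [hx]
    · have : (Icc a b)ᶜ ∈ 𝓝 y := isClosed_Icc.isOpen_compl.mem_nhds hmem
      refine (continuousAt_const (y := (0 : ℝ))).congr ?_
      filter_upwards [this] with x hx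
      exact (indicator_of_notMem hx _).symm

lemma tendsto_bounded_continuous {f : ℂ → ℝ} (hf : ContinuousOn f lineRho) {C : ℝ}
    (hC : ∀ τ ∈ lineRho, |f τ| ≤ C) :
    Tendsto (fun k : ℕ => (∑ᶠ τ ∈ thetaZeros k, f τ) / ((k / 3 : ℕ) : ℝ)) atTop
      (𝓝 (∫ y in Ici (Real.sqrt 3 / 2), f (linePoint y) * (zeroDensity y).re)) := by
  -- Since f is controlled only on `lineRho`, the height is clamped at √3/2 to obtain a bounded
  -- continuous function on all of ℝ.
  set F : ℝ → ℝ := fun y => f (linePoint (max y (Real.sqrt 3 / 2))) with hFdef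
  have hmem : ∀ y : ℝ, linePoint (max y (Real.sqrt 3 / 2)) ∈ lineRho := fun y =>
    ⟨_, le_max_right y _, rfl⟩
  have hFeq : ∀ y, Real.sqrt 3 / 2 ≤ y → F y = f (linePoint y) := fun y hy => by
    simp only [hFdef, max_eq_left hy]
  have hcont : Continuous F := by
    refine hf.comp_continuous ?_ hmem
    unfold linePoint
    fun_prop
  have h := tendsto_average_zeroHeight (F := F) (C := C) (D := ∅) (fun y => hC _ (hmem y))
    countable_empty fun y _ => hcont.continuousAt
  rw [setIntegral_congr_fun measurableSet_Ici
    (g := fun y => f (linePoint y) * (zeroDensity y).re) fun y hy => by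
      simp only [hFeq y hy]] at h
  refine h.congr' ?_
  filter_upwards [eventually_ge_atTop 1] with k hk
  rw [finsum_thetaZeros hk]
  congr 1
  refine Finset.sum_congr rfl fun m hm => hFeq _ ?_
  exact (sqrt_lt_lineHeight ((arcZero_spec hk).1 m (Finset.mem_range.mp hm)).2.1).le

end LatticeTheta

theorem theorem2 :
    -- all zeros (other than `ρ`) in the fundamental domain lie on `L_ρ`; there are `⌊k/3⌋` of them
    (∀ k : ℕ, 1 ≤ k →
      LatticeTheta.thetaZeros k ⊆ LatticeTheta.lineRho ∧
        (LatticeTheta.thetaZeros k).encard = ((k / 3 : ℕ) : ℕ∞)) ∧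
    -- `ϱ` is a real non-negative density on `L_ρ`
    (∀ y : ℝ, Real.sqrt 3 / 2 ≤ y →
      (LatticeTheta.zeroDensity y).im = 0 ∧ 0 ≤ (LatticeTheta.zeroDensity y).re) ∧
    -- equidistribution, tested on intervals
    (∀ a b : ℝ, Real.sqrt 3 / 2 ≤ a → a ≤ b →
      Filter.Tendsto
        (fun k : ℕ =>
          (({τ ∈ LatticeTheta.thetaZeros k | τ.im ∈ Set.Icc a b}.ncard : ℕ) : ℝ) /
            ((k / 3 : ℕ) : ℝ))
        Filter.atTop
        (nhds (∫ y in a..b, (LatticeTheta.zeroDensity y).re))) ∧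
    -- equidistribution, tested on bounded continuous functions on `L_ρ`
    (∀ f : ℂ → ℝ, ContinuousOn f LatticeTheta.lineRho →
      (∃ C : ℝ, ∀ τ ∈ LatticeTheta.lineRho, |f τ| ≤ C) →
      Filter.Tendsto
        (fun k : ℕ => (∑ᶠ τ ∈ LatticeTheta.thetaZeros k, f τ) / ((k / 3 : ℕ) : ℝ))
        Filter.atTop
        (nhds (∫ y in Set.Ici (Real.sqrt 3 / 2),
          f (LatticeTheta.linePoint y) * (LatticeTheta.zeroDensity y).re))) ∧
    -- the asymptotics of `ϱ`
    Asymptotics.IsEquivalent Filter.atTop LatticeTheta.zeroDensity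
      (fun y : ℝ => ((48 * Real.exp (-Real.pi * y) : ℝ) : ℂ)) := by
  have hs := LatticeTheta.three_quarters_lt_sqrt
  refine ⟨fun k hk => ⟨LatticeTheta.thetaZeros_subset_lineRho hk, LatticeTheta.thetaZeros_encard hk⟩,
    fun y hy => ⟨LatticeTheta.zeroDensity_im (by linarith),
      (LatticeTheta.zeroDensity_re_pos (by linarith)).le⟩,
    fun a b ha hab => LatticeTheta.tendsto_interval ha hab,
    fun f hf ⟨C, hC⟩ => LatticeTheta.tendsto_bounded_continuous hf hC,
    LatticeTheta.isEquivalent_zeroDensity⟩
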